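/- **Conventions.** Maps are partial unless called total. $\mathcal T$ is the set of machines computing partial maps $\mathbb N\to\mathbb N$ (Turing machines, represented by the standard programs for the partial recursive functions with their Gödel numbering). An encoding of a set $B$ is an injective total map $e:B\to\mathbb N$ with computable range; $B\times\{\pm\}$ is encoded by pairing, with $-\mapsto 0$, $+\mapsto 1$. $T\in\mathcal T$ computes $f:A\to B$ if $T\circ e_A=e_B\circ f$ as partial maps. For a first order language, $\mathcal L$ denotes its set of sentences, with a fixed encoding, and $\mathcal T_{\mathcal L}$ is the set of $T\in\mathcal T$ that compute some (then unique) map $T':\mathbb N\to\mathcal L\times\{\pm\}$. For $M:\mathbb N\to\mathcal L\times\{\pm\}$ the stabilization $M^s\subset\mathcal L$ is the set of $\alpha$ such that $M(m)=(\alpha,+)$ for some $m$ and $M(n)=(\alpha,-)$ for no $n>m$; for $T\in\mathcal T_{\mathcal L}$ put $T^s=(T')^s$. A set of sentences is consistent if it does not prove some sentence together with its negation. $\mathcal A$ is the set of sentences of arithmetic, in the symbols $0,+,\times,s,<$, with a standard Gödel numbering; $Q\subset\mathcal A$ is Robinson arithmetic; $\mathcal F_0$ is the set of $\Sigma^0_0$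 formulas (all quantifiers bounded) with one free variable. A translation $i:\mathcal A\to\mathcal L$ is an injective total map that preserves $\land,\lor,\neg$ and such that $S\vdash\alpha$ implies $i(S)\vdash i(\alpha)$ for all $S\subset\mathcal A$, $\alpha\in\mathcal A$. It is a $2$-translation if its restriction to the $\Sigma^0_2$ sentences is computable; here the syntactic classes are cumulative, in particular $\Pi^0_1\subset\Sigma^0_2$. For $F\subset\mathcal L$ and $\alpha\in\mathcal A$ write $F\vdash^i\alpha$ if $\{\beta\in\mathcal A: F\vdash i(\beta)\}\vdash\alpha$, and $F\vdash^i Q$ if $F\vdash^i\alpha$ for all $\alpha\in Q$. $F$ is $1$-consistent relative to $i$ if $F\vdash^i Q$ and for every $\varphi\in\mathcal F_0$: if $F\vdash^i\exists m\,\varphi(m)$ then there is $m\in\mathbb N$ such that $F\nvdash^i\neg\varphi(m)$. $M:\mathbb N\to\mathcal L\times\{\pm\}$ is speculative with respect to $i$ if for every $\varphi\in\mathcal F_0$ with $Q\vdash\varphi(m)$ for all $m\in\mathbb N$ one has $M^s\vdash^i\forall m\,\varphi(m)$. **Theorem.** Let $\mathcal L$ be given and let $i:\mathcal A\to\mathcal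 L$ be a fixed $2$-translation. Then there is a total computable map $\mathrm{Spec}_i:\mathcal T\to\mathcal T$ with the following properties, where $T_{spec}=\mathrm{Spec}_i(T)$. 1. $\mathrm{Spec}_i(T)\in\mathcal T_{\mathcal L}$ for every $T\in\mathcal T$. 2. If $T\in\mathcal T_{\mathcal L}$ and $T^s\vdash^i Q$, then $T'_{spec}$ is speculative with respect to $i$; moreover, if $T'$ is total then so is $T'_{spec}$. 3. If $T\in\mathcal T_{\mathcal L}$, then $T_{spec}^s\supset T^s$. 4. If $T\in\mathcal T_{\mathcal L}$ and $T^s$ is $1$-consistent relative to $i$, then $T_{spec}^s$ is consistent. -/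

import Mathlib

universe u v

namespace StableTheory

open FirstOrder FirstOrder.Language

/-! ### Encodings and machines

`Nat.Partrec.Code` with its Goedel numbering `Encodable.encode` is used as the set of machines
computing partial maps `ℕ → ℕ`; `T.eval` is the partial map of the machine `T`.
Partial maps are `A →. B`.  The two marks are the Booleans: `true` is `+`, `false` is `-`. -/

/-- An encoding map: an injective total map to `ℕ` whose range is computable. -/
def IsEncoding {A : Type*} (e : A → ℕ) : Prop :=
  Function.Injective e ∧ ComputablePred fun n : ℕ => n ∈ Set.range e

/-- The machine `T` computes the partial map `f : A → B` with respect to the encodings `eA`, `eB`: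
the square `T ∘ eA = eB ∘ f` commutes (as partial maps). -/
def Computes {A B : Type*} (eA : A → ℕ) (eB : B → ℕ) (T : Nat.Partrec.Code) (f : A →. B) : Prop :=
  ∀ a, T.eval (eA a) = (f a).map eB

/-- The encoding of `B × {±}` obtained from an encoding of `B`, with `- ↦ 0` and `+ ↦ 1`. -/
def markedCode {B : Type*} (e : B → ℕ) (x : B × Bool) : ℕ :=
  Nat.pair (e x.1) x.2.toNat

/-- The machine `T` computes the map `M : ℕ → B × {±}`. For injective `e` there is at most one such
`M`. -/
def ComputesMarked {B : Type*} (e : B → ℕ) (T : Nat.Partrec.Code) (M : ℕ →. B × Bool) : Prop :=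
  Computes id (markedCode e) T M

/-- The set of machines that compute some map `ℕ → B × {±}`. -/
def markedMachines {B : Type*} (e : B → ℕ) : Set Nat.Partrec.Code :=
  {T | ∃ M : ℕ →. B × Bool, ComputesMarked e T M}

/-- The stabilization of `M`: the set of all `b` such that `M m = (b, +)` for some `m` and
`M n = (b, -)` for no `n > m`. -/
def stabilization {B : Type*} (M : ℕ →. B × Bool) : Set B :=
  {b | ∃ m, (b, true) ∈ M m ∧ ∀ n, m < n → (b, false) ∉ M n}

/-- The partial map `M` is total. -/
def IsTotal {B : Type*} (M : ℕ →. B) : Prop :=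
  ∀ n, (M n).Dom

/-! ### First order provability -/

section Provability

variable {L : FirstOrder.Language.{u, v}}

/-- `ψ(t)`, for a formula `ψ` in which the variable `&0` is not quantified; capture is impossible,
since the variables of `t` are never quantified. -/
def instantiate {α : Type} (ψ : L.BoundedFormula α 1) (t : L.Term α) : L.Formula α :=
  ψ.toFormula.subst (Sum.elim Term.var fun _ => t)

/-- Renames the free variables by `k ↦ k + 1`, which makes `0` a fresh variable. -/
def shift (φ : L.Formula ℕ) : L.Formula ℕ :=
  φ.relabel Nat.succ

/-- `ψ(x)` for the fresh variable `x = 0`, the other free variables being renamed as in `shift`. -/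
def instantiateFresh (ψ : L.BoundedFormula ℕ 1) : L.Formula ℕ :=
  ψ.toFormula.relabel (Sum.elim Nat.succ fun _ => 0)

/-- Natural deduction for classical first order logic with equality. The connectives `¬ ∧ ∨ ∃` are
defined from `⊥ → ∀` in the usual way. -/
inductive Derivable : Set (L.Formula ℕ) → L.Formula ℕ → Prop
  | hyp {Γ : Set (L.Formula ℕ)} {φ : L.Formula ℕ} (h : φ ∈ Γ) : Derivable Γ φ
  | impI {Γ : Set (L.Formula ℕ)} {φ ψ : L.Formula ℕ} (h : Derivable (insert φ Γ) ψ) :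
      Derivable Γ (φ.imp ψ)
  | impE {Γ : Set (L.Formula ℕ)} {φ ψ : L.Formula ℕ} (h₁ : Derivable Γ (φ.imp ψ))
      (h₂ : Derivable Γ φ) : Derivable Γ ψ
  | raa {Γ : Set (L.Formula ℕ)} {φ : L.Formula ℕ}
      (h : Derivable (insert φ.not Γ) BoundedFormula.falsum) : Derivable Γ φ
  | allI {Γ : Set (L.Formula ℕ)} {ψ : L.BoundedFormula ℕ 1}
      (h : Derivable (shift '' Γ) (instantiateFresh ψ)) : Derivable Γ ψ.all
  | allE {Γ : Set (L.Formula ℕ)} {ψ : L.BoundedFormula ℕ 1} (t : L.Term ℕ)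
      (h : Derivable Γ ψ.all) : Derivable Γ (instantiate ψ t)
  | eqRefl {Γ : Set (L.Formula ℕ)} (t : L.Term ℕ) : Derivable Γ (t.equal t)
  | eqSubst {Γ : Set (L.Formula ℕ)} (ψ : L.BoundedFormula ℕ 1) {t u : L.Term ℕ}
      (h₁ : Derivable Γ (t.equal u)) (h₂ : Derivable Γ (instantiate ψ t)) :
      Derivable Γ (instantiate ψ u)

/-- A sentence as a formula with variables. -/
def ofSentence (α : L.Sentence) : L.Formula ℕ :=
  Formula.relabel (Empty.elim : Empty → ℕ) α

/-- `F ⊢ α`. -/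
def Proves (F : Set L.Sentence) (α : L.Sentence) : Prop :=
  Derivable (ofSentence '' F) (ofSentence α)

/-- The deductive closure of `F`. -/
def deductiveClosure (F : Set L.Sentence) : Set L.Sentence :=
  {α | Proves F α}

/-- No sentence is provable together with its negation. -/
def Consistent (F : Set L.Sentence) : Prop :=
  ¬ ∃ α : L.Sentence, Proves F α ∧ Proves F α.not

end Provability

/-! ### Arithmetic -/

/-- The function symbols `0, s, +, ×`. -/
inductive ArithFunc : ℕ → Type
  | zero : ArithFunc 0
  | succ : ArithFunc 1
  | add : ArithFunc 2
  | mul : ArithFunc 2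

/-- The relation symbol `<`. -/
inductive ArithRel : ℕ → Type
  | lt : ArithRel 2

/-- The first order language of arithmetic, with symbols `0, +, ×, s, <`. -/
def arith : FirstOrder.Language.{0, 0} :=
  ⟨ArithFunc, ArithRel⟩

namespace Arith

/-- The term `0`. -/
def zero {α : Type} : arith.Term α :=
  Term.func (L := arith) ArithFunc.zero ![]

/-- The term `s t`. -/
def succ {α : Type} (t : arith.Term α) : arith.Term α :=
  Term.func (L := arith) ArithFunc.succ ![t]

/-- The term `t + u`. -/
def add {α : Type} (t u : arith.Term α) : arith.Term α :=
  Term.func (L := arith) ArithFunc.add ![t, u]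

/-- The term `t × u`. -/
def mul {α : Type} (t u : arith.Term α) : arith.Term α :=
  Term.func (L := arith) ArithFunc.mul ![t, u]

/-- The formula `t < u`. -/
def lt {α : Type} {n : ℕ} (t u : arith.Term (α ⊕ Fin n)) : arith.BoundedFormula α n :=
  BoundedFormula.rel (L := arith) ArithRel.lt ![t, u]

/-- The numeral of `m`. -/
def numeral {α : Type} : ℕ → arith.Term α
  | 0 => zero
  | m + 1 => succ (numeral m)

/-- The Goedel number of a term. -/
def termCode {n : ℕ} : arith.Term (Empty ⊕ Fin n) → ℕ
  | .var (.inl x) => x.elim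
  | .var (.inr k) => Nat.pair 0 k
  | .func ArithFunc.zero _ => Nat.pair 1 0
  | .func ArithFunc.succ ts => Nat.pair 2 (termCode (ts 0))
  | .func ArithFunc.add ts => Nat.pair 3 (Nat.pair (termCode (ts 0)) (termCode (ts 1)))
  | .func ArithFunc.mul ts => Nat.pair 4 (Nat.pair (termCode (ts 0)) (termCode (ts 1)))

/-- The Goedel number of a formula. -/
def code : {n : ℕ} → arith.BoundedFormula Empty n → ℕ
  | _, .falsum => Nat.pair 0 0
  | _, .equal t u => Nat.pair 1 (Nat.pair (termCode t) (termCode u))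
  | _, .rel ArithRel.lt ts => Nat.pair 2 (Nat.pair (termCode (ts 0)) (termCode (ts 1)))
  | _, .imp φ ψ => Nat.pair 3 (Nat.pair (code φ) (code ψ))
  | _, .all φ => Nat.pair 4 (code φ)

/-- The formula `x < t`, for `x` the last variable and a term `t` in which `x` does not occur. -/
def lastLt {n : ℕ} (t : arith.Term (Empty ⊕ Fin n)) : arith.BoundedFormula Empty (n + 1) :=
  lt (Term.var (Sum.inr (Fin.last n))) (t.relabel (Sum.map id Fin.castSucc))

/-- The `Σ⁰₀` formulas: all quantifiers are bounded, `∀ x < t` or `∃ x < t`. -/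
inductive IsSigmaZero : {n : ℕ} → arith.BoundedFormula Empty n → Prop
  | falsum {n : ℕ} : IsSigmaZero (BoundedFormula.falsum : arith.BoundedFormula Empty n)
  | equal {n : ℕ} (t u : arith.Term (Empty ⊕ Fin n)) : IsSigmaZero (BoundedFormula.equal t u)
  | lt {n : ℕ} (t u : arith.Term (Empty ⊕ Fin n)) : IsSigmaZero (Arith.lt t u)
  | imp {n : ℕ} {φ ψ : arith.BoundedFormula Empty n} (hφ : IsSigmaZero φ) (hψ : IsSigmaZero ψ) :
      IsSigmaZero (φ.imp ψ)
  | ball {n : ℕ} (t : arith.Term (Empty ⊕ Fin n)) {φ : arith.BoundedFormula Empty (n + 1)}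
      (hφ : IsSigmaZero φ) : IsSigmaZero ((lastLt t).imp φ).all
  | bex {n : ℕ} (t : arith.Term (Empty ⊕ Fin n)) {φ : arith.BoundedFormula Empty (n + 1)}
      (hφ : IsSigmaZero φ) : IsSigmaZero (lastLt t ⊓ φ).ex

/-- The arithmetical hierarchy of formulas: `InHierarchy true n` is `Σ⁰ₙ`, `InHierarchy false n` is
`Π⁰ₙ`. The classes at level `0` are the `Σ⁰₀` formulas; `Σ⁰ₙ₊₁` contains `Σ⁰ₙ` and `Π⁰ₙ` and is
closed under `∃`; `Π⁰ₙ₊₁` contains `Σ⁰ₙ` and `Π⁰ₙ` and is closed under `∀`. -/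
inductive InHierarchy : Bool → ℕ → {k : ℕ} → arith.BoundedFormula Empty k → Prop
  | zero {b : Bool} {k : ℕ} {φ : arith.BoundedFormula Empty k} (h : IsSigmaZero φ) :
      InHierarchy b 0 φ
  | up {b b₁ : Bool} {n k : ℕ} {φ : arith.BoundedFormula Empty k} (h : InHierarchy b n φ) :
      InHierarchy b₁ (n + 1) φ
  | ex {n k : ℕ} {φ : arith.BoundedFormula Empty (k + 1)} (h : InHierarchy true (n + 1) φ) :
      InHierarchy true (n + 1) φ.ex
  | all {n k : ℕ} {φ : arith.BoundedFormula Empty (k + 1)} (h : InHierarchy false (n + 1) φ) :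
      InHierarchy false (n + 1) φ.all

/-- The sentence is `Σ⁰ₙ`. -/
def IsSigma (n : ℕ) (α : arith.Sentence) : Prop :=
  InHierarchy true n α

/-- Robinson arithmetic:
`s x ≠ 0`; `s x = s y → x = y`; `x ≠ 0 → ∃ y, x = s y`; `x + 0 = x`; `x + s y = s (x + y)`;
`x × 0 = 0`; `x × s y = x × y + x`; `x < y ↔ ∃ z, s z + x = y`. -/
def Q : Set arith.Sentence :=
  { ∀' ∼(succ (&0) =' zero),
    ∀' ∀' ((succ (&0) =' succ (&1)) ⟹ (&0 =' &1)),
    ∀' (∼(&0 =' zero) ⟹ ∃' (&0 =' succ (&1))),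
    ∀' (add (&0) zero =' &0),
    ∀' ∀' (add (&0) (succ (&1)) =' succ (add (&0) (&1))),
    ∀' (mul (&0) zero =' zero),
    ∀' ∀' (mul (&0) (succ (&1)) =' add (mul (&0) (&1)) (&0)),
    ∀' ∀' (lt (&0) (&1) ⇔ ∃' (add (succ (&2)) (&0) =' &1)) }

end Arith

/-! ### Translations and the notions relative to them -/

section Translations

variable {L : FirstOrder.Language.{u, v}}

/-- A translation between the sets of sentences of two first order languages: an injective map that
preserves `∧`, `∨`, `¬` and provability. -/
structure IsTranslation {L₁ : FirstOrder.Language.{0, 0}} (i : L₁.Sentence → L.Sentence) : Prop where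
  injective : Function.Injective i
  map_and : ∀ α β : L₁.Sentence, i (α ⊓ β) = i α ⊓ i β
  map_or : ∀ α β : L₁.Sentence, i (α ⊔ β) = i α ⊔ i β
  map_not : ∀ α : L₁.Sentence, i α.not = (i α).not
  map_proves : ∀ (S : Set L₁.Sentence) (α : L₁.Sentence), Proves S α → Proves (i '' S) (i α)

/-- An `n`-translation from the language of arithmetic to `L`, whose sentences are encoded by `e`:
a translation whose restriction to the `Σ⁰ₙ` sentences is computable. -/
def IsNTranslation (n : ℕ) (e : L.Sentence → ℕ) (i : arith.Sentence → L.Sentence) : Prop :=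
  IsTranslation i ∧
    ∃ T : Nat.Partrec.Code,
      Computes (fun α : {α : arith.Sentence // Arith.IsSigma n α} => Arith.code α.1) e T
        (fun α => Part.some (i α.1))

/-- The arithmetic sentences that `F` proves under `i`: the preimage of the deductive closure. -/
def pullback (i : arith.Sentence → L.Sentence) (F : Set L.Sentence) : Set arith.Sentence :=
  i ⁻¹' deductiveClosure F

/-- `F ⊢ⁱ α`. -/
def ProvesVia (i : arith.Sentence → L.Sentence) (F : Set L.Sentence) (α : arith.Sentence) : Prop :=
  Proves (pullback i F) α

/-- `F ⊢ⁱ Q`. -/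
def ProvesQVia (i : arith.Sentence → L.Sentence) (F : Set L.Sentence) : Prop :=
  ∀ α ∈ Arith.Q, ProvesVia i F α

/-- `F` is `1`-consistent relative to `i`. -/
def OneConsistent (i : arith.Sentence → L.Sentence) (F : Set L.Sentence) : Prop :=
  ProvesQVia i F ∧
    ∀ φ : arith.BoundedFormula Empty 1, Arith.IsSigmaZero φ →
      ProvesVia i F φ.ex →
        ∃ m : ℕ, ¬ ProvesVia i F (instantiate φ (Arith.numeral m)).not

/-- `M` is speculative with respect to `i`. -/
def Speculative (i : arith.Sentence → L.Sentence) (M : ℕ →. L.Sentence × Bool) : Prop :=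
  ∀ φ : arith.BoundedFormula Empty 1, Arith.IsSigmaZero φ →
    (∀ m : ℕ, Proves Arith.Q (instantiate φ (Arith.numeral m))) →
      ProvesVia i (stabilization M) φ.all

end Translations

end StableTheory

namespace StableTheory

open FirstOrder FirstOrder.Language

/-! ### Parallel substitution -/

section Substitution

variable {L : FirstOrder.Language.{u, v}} {α β γ : Type} {k l m n : ℕ}

/-! The sentences `i (∀ m, φ(m))`, for `φ` a `Σ⁰₀` formula, are treated as conjectures: each one is
asserted until a number `m` with `φ(m)` false is found, and is then retracted. Truth of `φ(m)` is
decidable (`primrec_evalFormula`), so a false conjecture is eventually withdrawn and a true one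
survives forever. Since `Q` is sound for `ℕ`, a formula all of whose instances are provable in `Q`
is never refuted, and this makes the enriched stream speculative. The conjectures are images of
`Π⁰₁` sentences, hence of `Σ⁰₂` sentences, so a `2`-translation computes their codes.

The delicate point is that the given machine `T` may itself pronounce on a conjectured sentence. The
stream is built so that its stabilization is exactly that of `T` together with the true conjectures.
While a conjecture is live, a `-` issued by `T` is overwritten by `+`. When it is refuted, one `-`
is issued and all earlier outputs of `T` on this sentence are replayed in order; from then on `T` is
followed literally, so the final verdict is that of `T` alone. This is the content of
`stabilizes_of_holds`, `stabilizes_stream_of_stabilizes` and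
`stabilizes_or_holds_of_stabilizes_stream`. Each output consults at most one value of `T`, so
divergence of `T` at one input does not block the others, and totality is inherited.

For consistency let `F` be the stabilization of `T`. A contradiction in the enriched theory uses
finitely many true conjectures, and these follow from a single one `i (∀ m, φ(m))`, obtained by
conjoining the formulas inside the quantifier. Hence `F` proves `i (¬ ∀ m, φ(m))`, that is, `F ⊢ⁱ ∃
m, ¬φ(m)`. By `1`-consistency there is `m` with `F ⊬ⁱ ¬¬φ(m)`. But `φ(m)` is a true `Σ⁰₀` sentence,
hence provable in `Q` (`sigmaZero_decided`), and `F ⊢ⁱ Q`; this is a contradiction. -/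

theorem subst_relabel (t : L.Term α) (g : α → β) (τ : β → L.Term γ) :
    (t.relabel g).subst τ = t.subst (τ ∘ g) := by
  induction t with
  | var => rfl
  | func f ts ih => simp [ih]

theorem relabel_subst (t : L.Term α) (τ : α → L.Term β) (g : β → γ) :
    (t.subst τ).relabel g = t.subst fun x => (τ x).relabel g := by
  induction t with
  | var => rfl
  | func f ts ih => simp [ih]

theorem subst_subst (t : L.Term α) (σ : α → L.Term β) (τ : β → L.Term γ) :
    (t.subst σ).subst τ = t.subst fun x => (σ x).subst τ := by
  induction t with
  | var => rfl
  | func f ts ih => simp [ih]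

theorem subst_var (t : L.Term α) : t.subst Term.var = t := by
  induction t with
  | var => rfl
  | func f ts ih => simp [ih]

theorem relabel_eq_subst (t : L.Term α) (g : α → β) :
    t.relabel g = t.subst fun x => Term.var (g x) := by
  induction t with
  | var => rfl
  | func f ts ih => simp [ih]

/-- The substitution `σ` under a quantifier. -/
def liftSubst (σ : α ⊕ Fin n → L.Term (β ⊕ Fin m)) :
    α ⊕ Fin (n + 1) → L.Term (β ⊕ Fin (m + 1)) :=
  Sum.elim (fun a => (σ (Sum.inl a)).relabel (Sum.map id Fin.castSucc))
    (Fin.lastCases (Term.var (Sum.inr (Fin.last m)))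
      fun j => (σ (Sum.inr j)).relabel (Sum.map id Fin.castSucc))

@[simp]
theorem liftSubst_inl (σ : α ⊕ Fin n → L.Term (β ⊕ Fin m)) (a : α) :
    liftSubst σ (Sum.inl a) = (σ (Sum.inl a)).relabel (Sum.map id Fin.castSucc) :=
  rfl

@[simp]
theorem liftSubst_castSucc (σ : α ⊕ Fin n → L.Term (β ⊕ Fin m)) (j : Fin n) :
    liftSubst σ (Sum.inr j.castSucc) = (σ (Sum.inr j)).relabel (Sum.map id Fin.castSucc) := by
  simp [liftSubst]

@[simp]
theorem liftSubst_last (σ : α ⊕ Fin n → L.Term (β ⊕ Fin m)) :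
    liftSubst σ (Sum.inr (Fin.last n)) = Term.var (Sum.inr (Fin.last m)) := by
  simp [liftSubst]

theorem liftSubst_map (σ : α ⊕ Fin n → L.Term (β ⊕ Fin m)) (x : α ⊕ Fin n) :
    liftSubst σ (Sum.map id Fin.castSucc x) = (σ x).relabel (Sum.map id Fin.castSucc) := by
  rcases x with a | j <;> simp

/-- Capture-avoiding parallel substitution of terms for all the variables of a formula. -/
def bsubst : {n m : ℕ} → L.BoundedFormula α n → (α ⊕ Fin n → L.Term (β ⊕ Fin m)) →
    L.BoundedFormula β m
  | _, _, .falsum, _ => .falsum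
  | _, _, .equal t u, σ => .equal (t.subst σ) (u.subst σ)
  | _, _, .rel R ts, σ => .rel R fun j => (ts j).subst σ
  | _, _, .imp φ ψ, σ => .imp (bsubst φ σ) (bsubst ψ σ)
  | _, _, .all φ, σ => .all (bsubst φ (liftSubst σ))

theorem liftSubst_comp (σ : α ⊕ Fin n → L.Term (β ⊕ Fin m)) (τ : β ⊕ Fin m → L.Term (γ ⊕ Fin l)) :
    (fun x => (liftSubst σ x).subst (liftSubst τ)) = liftSubst fun x => (σ x).subst τ := by
  have key : ∀ t : L.Term (β ⊕ Fin m), (t.relabel (Sum.map id Fin.castSucc)).subst (liftSubst τ) =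
      (t.subst τ).relabel (Sum.map id Fin.castSucc) := fun t => by
    rw [subst_relabel, relabel_subst]
    congr 1
    funext x
    exact liftSubst_map τ x
  funext x
  rcases x with a | j
  · simp [key]
  · induction j using Fin.lastCases with
    | last => simp
    | cast j => simp [key]

/-- Relabelling, substitution, `toFormula`, and with them all instances in the deduction rules, are
special cases of `bsubst`. The commutation laws below thus reduce to this one and a comparison of
two substitutions on variables. -/
theorem bsubst_bsubst (φ : L.BoundedFormula α n) (σ : α ⊕ Fin n → L.Term (β ⊕ Fin m))
    (τ : β ⊕ Fin m → L.Term (γ ⊕ Fin l)) :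
    bsubst (bsubst φ σ) τ = bsubst φ fun x => (σ x).subst τ := by
  induction φ generalizing m l with
  | falsum => rfl
  | equal => simp [bsubst, subst_subst]
  | rel => simp [bsubst, subst_subst]
  | imp _ _ ih₁ ih₂ => simp [bsubst, ih₁, ih₂]
  | all _ ih => simp only [bsubst, ih, liftSubst_comp]

theorem relabel_eq_bsubst (φ : L.BoundedFormula α k) (g : α → β ⊕ Fin n) :
    φ.relabel g = bsubst φ fun x => Term.var (BoundedFormula.relabelAux g k x) := by
  have key : ∀ k, liftSubst (fun x : α ⊕ Fin k =>
      (Term.var (BoundedFormula.relabelAux g k x) : L.Term (β ⊕ Fin (n + k)))) =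
      fun x => Term.var (BoundedFormula.relabelAux g (k + 1) x) := fun k => by
    funext x
    rcases x with a | j
    · simp only [liftSubst_inl, BoundedFormula.relabelAux, Function.comp, Sum.map_inl,
        Term.relabel]
      rcases g a with b | i
      · simp
      · simp
        rfl
    · induction j using Fin.lastCases <;> simp [BoundedFormula.relabelAux]
  induction φ with
  | falsum => rfl
  | equal t u => simp [BoundedFormula.relabel, BoundedFormula.mapTermRel, bsubst, relabel_eq_subst]
  | rel R ts => simp [BoundedFormula.relabel, BoundedFormula.mapTermRel, bsubst, relabel_eq_subst]
  | imp _ _ ih₁ ih₂ => simp only [BoundedFormula.relabel_imp, bsubst, ih₁, ih₂]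
  | all _ ih => simp only [BoundedFormula.relabel_all, bsubst, key, ih]

theorem subst_eq_bsubst (φ : L.BoundedFormula α n) (f : α → L.Term β) :
    φ.subst f = bsubst φ (Sum.elim (fun a => (f a).relabel Sum.inl) fun j => Term.var (Sum.inr j)) := by
  have key : ∀ n, liftSubst (Sum.elim (fun a => (f a).relabel Sum.inl)
      fun j : Fin n => Term.var (Sum.inr j)) =
      Sum.elim (fun a => (f a).relabel Sum.inl) fun j => Term.var (Sum.inr j) := fun n => by
    funext x
    rcases x with a | j
    · simp [Function.comp_def]
    · induction j using Fin.lastCases <;> simp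
  induction φ with
  | falsum => rfl
  | equal t u => rfl
  | rel R ts => rfl
  | imp _ _ ih₁ ih₂ => simp only [BoundedFormula.subst, BoundedFormula.mapTermRel, bsubst] at *; rw [ih₁, ih₂]
  | all _ ih =>
    simp only [BoundedFormula.subst, BoundedFormula.mapTermRel, bsubst, key, id] at *
    rw [ih]

theorem toFormula_eq_bsubst (φ : L.BoundedFormula α n) :
    φ.toFormula = bsubst φ fun x => Term.var (Sum.inl x) := by
  induction φ with
  | falsum => rfl
  | equal t u => simp [BoundedFormula.toFormula, bsubst, Term.equal, Term.bdEqual, relabel_eq_subst]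
  | rel R ts => simp [BoundedFormula.toFormula, bsubst, Relations.formula, Relations.boundedFormula, relabel_eq_subst]
  | imp _ _ ih₁ ih₂ => simp only [BoundedFormula.toFormula, bsubst, ih₁, ih₂]
  | @all n φ ih =>
    simp only [BoundedFormula.toFormula, bsubst, ih]
    congr 1
    rw [relabel_eq_bsubst, bsubst_bsubst]
    congr 1
    funext x
    rcases x with a | j
    · rfl
    · induction j using Fin.lastCases with
      | last =>
        rw [liftSubst_last]
        simp only [Term.subst, BoundedFormula.relabelAux, Function.comp, Sum.map_inl, Sum.elim_inr]
        have : finSumFinEquiv.symm (Fin.last n) = (Sum.inr 0 : Fin n ⊕ Fin 1) :=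
          finSumFinEquiv_symm_last
        rw [this]
        rfl
      | cast j =>
        rw [liftSubst_castSucc]
        simp only [Term.subst, BoundedFormula.relabelAux, Function.comp, Sum.map_inl, Sum.elim_inr]
        have : finSumFinEquiv.symm j.castSucc = (Sum.inl j : Fin n ⊕ Fin 1) :=
          finSumFinEquiv_symm_apply_castAdd j
        rw [this]
        rfl

theorem instantiate_eq_bsubst (ψ : L.BoundedFormula α 1) (t : L.Term α) :
    instantiate ψ t =
      bsubst ψ (Sum.elim (fun a => Term.var (Sum.inl a)) fun _ => t.relabel Sum.inl) := by
  rw [instantiate, toFormula_eq_bsubst, subst_eq_bsubst, bsubst_bsubst]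
  congr 1
  funext x
  rcases x with a | j <;> rfl

theorem formula_relabel_eq_bsubst (φ : L.Formula α) (g : α → β) :
    Formula.relabel g φ = bsubst φ fun x => Term.var (Sum.map g id x) := by
  rw [Formula.relabel, relabel_eq_bsubst]
  congr 1
  funext x
  rcases x with a | j
  · rfl
  · exact j.elim0

theorem shift_eq_bsubst (φ : L.Formula ℕ) :
    shift φ = bsubst φ fun x => Term.var (Sum.map Nat.succ id x) :=
  formula_relabel_eq_bsubst φ _

theorem instantiateFresh_eq_bsubst (ψ : L.BoundedFormula ℕ 1) :
    instantiateFresh ψ =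
      bsubst ψ (Sum.elim (fun k => Term.var (Sum.inl (k + 1))) fun _ => Term.var (Sum.inl 0)) := by
  rw [instantiateFresh, toFormula_eq_bsubst, formula_relabel_eq_bsubst, bsubst_bsubst]
  congr 1
  funext x
  rcases x with a | j <;> rfl

theorem ofSentence_eq_bsubst (α : L.Sentence) :
    ofSentence α = bsubst α fun x => Term.var (Sum.map Empty.elim id x) :=
  formula_relabel_eq_bsubst α _

@[simp]
theorem bsubst_not (φ : L.BoundedFormula α n) (σ : α ⊕ Fin n → L.Term (β ⊕ Fin m)) :
    bsubst φ.not σ = (bsubst φ σ).not :=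
  rfl

theorem instantiate_bsubst (ψ : L.BoundedFormula α (n + 1)) (σ : α ⊕ Fin n → L.Term (β ⊕ Fin 0))
    (t : L.Term β) :
    instantiate (bsubst ψ (liftSubst σ)) t =
      bsubst ψ (Sum.elim (fun a => σ (Sum.inl a))
        (Fin.lastCases (t.relabel Sum.inl) fun j => σ (Sum.inr j))) := by
  have key : ∀ s : L.Term (β ⊕ Fin 0), (s.relabel (Sum.map id Fin.castSucc)).subst
      (Sum.elim (fun a => Term.var (Sum.inl a)) fun _ => t.relabel Sum.inl) = s := fun s => by
    rw [subst_relabel]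
    conv_rhs => rw [← subst_var s]
    congr 1
    funext x
    rcases x with a | j
    · rfl
    · exact j.elim0
  rw [instantiate_eq_bsubst, bsubst_bsubst]
  congr 1
  funext x
  rcases x with a | j
  · simp [key]
  · induction j using Fin.lastCases with
    | last => simp
    | cast j => simp [key]

theorem instantiateFresh_bsubst (ψ : L.BoundedFormula α (n + 1))
    (σ : α ⊕ Fin n → L.Term (ℕ ⊕ Fin 0)) :
    instantiateFresh (bsubst ψ (liftSubst σ)) =
      bsubst ψ (Sum.elim (fun a => (σ (Sum.inl a)).relabel (Sum.map Nat.succ id))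
        (Fin.lastCases (Term.var (Sum.inl 0))
          fun j => (σ (Sum.inr j)).relabel (Sum.map Nat.succ id))) := by
  have key : ∀ s : L.Term (ℕ ⊕ Fin 0), (s.relabel (Sum.map id Fin.castSucc)).subst
      (Sum.elim (fun k => Term.var (Sum.inl (k + 1))) fun _ => Term.var (Sum.inl 0)) =
      s.relabel (Sum.map Nat.succ id) := fun s => by
    rw [subst_relabel, relabel_eq_subst]
    congr 1
    funext x
    rcases x with a | j
    · rfl
    · exact j.elim0
  rw [instantiateFresh_eq_bsubst, bsubst_bsubst]
  congr 1
  funext x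
  rcases x with a | j
  · simp [key]
  · induction j using Fin.lastCases with
    | last => simp
    | cast j => simp [key]

end Substitution

/-! ### Structural properties of natural deduction -/

section Deduction

variable {L : FirstOrder.Language.{u, v}} {Γ Δ : Set (L.Formula ℕ)} {φ ψ χ : L.Formula ℕ}

namespace Derivable

theorem mono (h : Derivable Γ φ) (hΓ : Γ ⊆ Δ) : Derivable Δ φ := by
  induction h generalizing Δ with
  | hyp h => exact .hyp (hΓ h)
  | impI _ ih => exact .impI (ih (Set.insert_subset_insert hΓ))
  | impE _ _ ih₁ ih₂ => exact .impE (ih₁ hΓ) (ih₂ hΓ)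
  | raa _ ih => exact .raa (ih (Set.insert_subset_insert hΓ))
  | allI _ ih => exact .allI (ih (Set.image_mono hΓ))
  | allE t _ ih => exact .allE t (ih hΓ)
  | eqRefl t => exact .eqRefl t
  | eqSubst ψ _ _ ih₁ ih₂ => exact .eqSubst ψ (ih₁ hΓ) (ih₂ hΓ)

theorem weaken (h : Derivable Γ φ) : Derivable (insert ψ Γ) φ :=
  h.mono (Set.subset_insert _ _)

theorem head : Derivable (insert φ Γ) φ :=
  .hyp (Set.mem_insert _ _)

theorem cut (h₁ : Derivable Γ φ) (h₂ : Derivable (insert φ Γ) ψ) : Derivable Γ ψ :=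
  .impE (.impI h₂) h₁

theorem exfalso (h : Derivable Γ ⊥) : Derivable Γ φ :=
  .raa h.weaken

theorem notI (h : Derivable (insert φ Γ) ⊥) : Derivable Γ φ.not :=
  .impI h

theorem notE (h₁ : Derivable Γ φ.not) (h₂ : Derivable Γ φ) : Derivable Γ ψ :=
  exfalso (.impE h₁ h₂)

theorem notNotE (h : Derivable Γ φ.not.not) : Derivable Γ φ :=
  .raa (notE h.weaken head)

theorem notNotI (h : Derivable Γ φ) : Derivable Γ φ.not.not :=
  notI (notE head h.weaken)

theorem andI (h₁ : Derivable Γ φ) (h₂ : Derivable Γ ψ) : Derivable Γ (φ ⊓ ψ) :=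
  notI (notE (.impE head h₁.weaken) h₂.weaken)

theorem andLeft (h : Derivable Γ (φ ⊓ ψ)) : Derivable Γ φ :=
  .raa (notE h.weaken (.impI (notE head.weaken head)))

theorem andRight (h : Derivable Γ (φ ⊓ ψ)) : Derivable Γ ψ :=
  .raa (notE h.weaken (.impI head.weaken))

theorem byCases (h₁ : Derivable (insert φ Γ) χ) (h₂ : Derivable (insert φ.not Γ) χ) :
    Derivable Γ χ :=
  .raa (notE head (cut (notI (notE head.weaken ((h₁.mono (Set.insert_subset_insert
    (Set.subset_insert _ _)))))) (h₂.mono (Set.insert_subset_insert (Set.subset_insert _ _)))))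

theorem exI {ψ : L.BoundedFormula ℕ 1} (t : L.Term ℕ) (h : Derivable Γ (instantiate ψ t)) :
    Derivable Γ ψ.ex :=
  notI (notE (.allE (ψ := ψ.not) t head) h.weaken)

theorem exE {ψ : L.BoundedFormula ℕ 1} (h₁ : Derivable Γ ψ.ex)
    (h₂ : Derivable (insert (instantiateFresh ψ) (shift '' Γ)) (shift χ)) : Derivable Γ χ := by
  refine .raa (notE h₁.weaken (.allI (notI ?_)))
  refine notE (φ := shift χ) (.hyp ?_) (h₂.mono ?_)
  · exact Set.mem_insert_of_mem _ ⟨_, Set.mem_insert _ _, rfl⟩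
  · exact Set.insert_subset_insert (Set.image_mono (Set.subset_insert _ _))

theorem relabel (h : Derivable Γ φ) (ρ : ℕ → ℕ) :
    Derivable (Formula.relabel ρ '' Γ) (Formula.relabel ρ φ) := by
  have key (ψ : L.BoundedFormula ℕ 1) (t : L.Term ℕ) (ρ : ℕ → ℕ) :
      Formula.relabel ρ (instantiate ψ t) =
        instantiate (bsubst ψ fun x => Term.var (Sum.map ρ id x)) (t.relabel ρ) := by
    rw [formula_relabel_eq_bsubst, instantiate_eq_bsubst, instantiate_eq_bsubst, bsubst_bsubst,
      bsubst_bsubst]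
    congr 1
    funext x
    rcases x with a | j
    · rfl
    · simp [← relabel_eq_subst, Function.comp_def]
  have key₂ (ψ : L.BoundedFormula ℕ 1) (ρ : ℕ → ℕ) :
      Formula.relabel ρ ψ.all = (bsubst ψ fun x => Term.var (Sum.map ρ id x)).all := by
    rw [formula_relabel_eq_bsubst, bsubst]
    congr 2
    funext x
    rcases x with a | j
    · rfl
    · obtain rfl : j = Fin.last 0 := Subsingleton.elim (α := Fin 1) _ _
      exact liftSubst_last _
  induction h generalizing ρ with
  | hyp h => exact .hyp ⟨_, h, rfl⟩
  | impI _ ih =>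
    have := ih ρ
    rw [Set.image_insert_eq] at this
    exact .impI this
  | impE _ _ ih₁ ih₂ => exact .impE (ih₁ ρ) (ih₂ ρ)
  | raa _ ih =>
    have := ih ρ
    rw [Set.image_insert_eq] at this
    exact .raa this
  | @allI Γ ψ _ ih =>
    rw [key₂]
    refine .allI ?_
    -- Under the quantifier the renaming fixes the eigenvariable `0` and acts as `ρ` on the shifted
    -- variables.
    have := ih fun k => k.casesOn 0 fun k => ρ k + 1
    convert this using 1
    · simp only [Set.image_image]
      congr 1
      funext φ
      simp only [shift, formula_relabel_eq_bsubst, bsubst_bsubst]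
      congr 1
      funext x
      rcases x with a | j <;> rfl
    · rw [instantiateFresh_eq_bsubst, formula_relabel_eq_bsubst, instantiateFresh_eq_bsubst,
        bsubst_bsubst, bsubst_bsubst]
      congr 1
      funext x
      rcases x with a | j <;> rfl
  | allE t _ ih =>
    rw [key]
    have := ih ρ
    rw [key₂] at this
    exact .allE _ this
  | eqRefl t =>
    have : Formula.relabel ρ (t.equal t) = (t.relabel ρ).equal (t.relabel ρ) := by
      simp [formula_relabel_eq_bsubst, Term.equal, Term.bdEqual, bsubst, relabel_eq_subst,
        subst_subst]
    rw [this]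
    exact .eqRefl _
  | @eqSubst Γ ψ t u _ _ ih₁ ih₂ =>
    rw [key]
    have h₁ := ih₁ ρ
    have : Formula.relabel ρ (t.equal u) = (t.relabel ρ).equal (u.relabel ρ) := by
      simp [formula_relabel_eq_bsubst, Term.equal, Term.bdEqual, bsubst, relabel_eq_subst,
        subst_subst]
    rw [this] at h₁
    have h₂ := ih₂ ρ
    rw [key] at h₂
    exact .eqSubst _ h₁ h₂

theorem shift (h : Derivable Γ φ) : Derivable (shift '' Γ) (shift φ) :=
  h.relabel _

/-- A derivation is a finite tree. Rules that discharge a hypothesis remove it from the finite set;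
for `allI` a finite part of `shift '' Γ` is the image of a finite part of `Γ`. -/
theorem exists_finite (h : Derivable Γ φ) : ∃ Δ ⊆ Γ, Δ.Finite ∧ Derivable Δ φ := by
  have key {Γ Δ : Set (L.Formula ℕ)} {φ : L.Formula ℕ} (h : Δ ⊆ insert φ Γ) (hf : Δ.Finite) :
      Δ \ {φ} ⊆ Γ ∧ (Δ \ {φ}).Finite ∧ Δ ⊆ insert φ (Δ \ {φ}) := by
    refine ⟨fun x hx => (h hx.1).resolve_left hx.2, hf.subset Set.sdiff_subset, fun x hx => ?_⟩
    by_cases hxφ : x = φ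
    · exact Or.inl hxφ
    · exact Or.inr ⟨hx, hxφ⟩
  induction h with
  | @hyp Γ φ h => exact ⟨{φ}, by simpa using h, Set.finite_singleton _, .hyp rfl⟩
  | impI _ ih =>
    obtain ⟨Δ, h, hf, hd⟩ := ih
    obtain ⟨h₁, h₂, h₃⟩ := key h hf
    exact ⟨_, h₁, h₂, .impI (hd.mono h₃)⟩
  | impE _ _ ih₁ ih₂ =>
    obtain ⟨Δ₁, h₁, hf₁, hd₁⟩ := ih₁
    obtain ⟨Δ₂, h₂, hf₂, hd₂⟩ := ih₂
    exact ⟨Δ₁ ∪ Δ₂, Set.union_subset h₁ h₂, hf₁.union hf₂,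
      .impE (hd₁.mono Set.subset_union_left) (hd₂.mono Set.subset_union_right)⟩
  | raa _ ih =>
    obtain ⟨Δ, h, hf, hd⟩ := ih
    obtain ⟨h₁, h₂, h₃⟩ := key h hf
    exact ⟨_, h₁, h₂, .raa (hd.mono h₃)⟩
  | allI _ ih =>
    obtain ⟨Δ', h', hf', hd⟩ := Set.exists_subset_image_finite_and.1 ih
    exact ⟨Δ', h', hf', .allI hd⟩
  | allE t _ ih =>
    obtain ⟨Δ, h, hf, hd⟩ := ih
    exact ⟨Δ, h, hf, .allE t hd⟩
  | eqRefl t => exact ⟨∅, Set.empty_subset _, Set.finite_empty, .eqRefl t⟩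
  | eqSubst ψ _ _ ih₁ ih₂ =>
    obtain ⟨Δ₁, h₁, hf₁, hd₁⟩ := ih₁
    obtain ⟨Δ₂, h₂, hf₂, hd₂⟩ := ih₂
    exact ⟨Δ₁ ∪ Δ₂, Set.union_subset h₁ h₂, hf₁.union hf₂,
      .eqSubst ψ (hd₁.mono Set.subset_union_left) (hd₂.mono Set.subset_union_right)⟩

theorem sound {M : Type*} [L.Structure M] [Nonempty M] (h : Derivable Γ φ) (w : ℕ → M)
    (hw : ∀ γ ∈ Γ, γ.Realize w) : φ.Realize w := by
  have hinst (ψ : L.BoundedFormula ℕ 1) (t : L.Term ℕ) (w : ℕ → M) :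
      (instantiate ψ t).Realize w ↔ ψ.Realize w fun _ => t.realize w := by
    rw [instantiate, Formula.Realize, BoundedFormula.realize_subst, ← Formula.Realize,
      BoundedFormula.realize_toFormula]
    rfl
  have hsnoc (a : M) : (Fin.snoc (α := fun _ => M) default a : Fin 1 → M) = fun _ => a := by
    funext j
    obtain rfl : j = Fin.last 0 := Subsingleton.elim (α := Fin 1) _ _
    exact Fin.snoc_last (α := fun _ => M) _ _
  induction h generalizing w with
  | hyp h => exact hw _ h
  | impI _ ih =>
    refine Formula.realize_imp.2 fun h => ih w ?_
    rintro γ (rfl | hγ)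
    exacts [h, hw γ hγ]
  | impE _ _ ih₁ ih₂ => exact Formula.realize_imp.1 (ih₁ w hw) (ih₂ w hw)
  | raa _ ih =>
    by_contra h
    refine ih w ?_
    rintro γ (rfl | hγ)
    exacts [Formula.realize_not.2 h, hw γ hγ]
  | @allI Γ ψ _ ih =>
    refine BoundedFormula.realize_all.2 fun a => ?_
    -- The eigenvariable `0` takes the value `a`; the shifted variables keep their values.
    have := ih (fun k => k.casesOn a w) ?_
    · rw [instantiateFresh, Formula.realize_relabel, BoundedFormula.realize_toFormula] at this
      rw [hsnoc]
      exact this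
    · rintro _ ⟨γ, hγ, rfl⟩
      rw [StableTheory.shift, Formula.realize_relabel]
      exact hw γ hγ
  | allE t _ ih =>
    rw [hinst, ← hsnoc]
    exact BoundedFormula.realize_all.1 (ih w hw) _
  | eqRefl t => exact Formula.realize_equal.2 rfl
  | eqSubst ψ _ _ ih₁ ih₂ =>
    rw [hinst, ← Formula.realize_equal.1 (ih₁ w hw), ← hinst]
    exact ih₂ w hw

theorem eqSymm {t u : L.Term ℕ} (h : Derivable Γ (t.equal u)) : Derivable Γ (u.equal t) := by
  have key (s : L.Term ℕ) : instantiate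
      (BoundedFormula.equal (Term.var (Sum.inr 0)) (t.relabel Sum.inl) : L.BoundedFormula ℕ 1) s =
        s.equal t := by
    rw [instantiate_eq_bsubst]
    simp [bsubst, Term.equal, Term.bdEqual, relabel_eq_subst, subst_subst]
  have := eqSubst _ h (key t ▸ eqRefl t)
  rwa [key] at this

theorem eqTrans {s t u : L.Term ℕ} (h₁ : Derivable Γ (s.equal t)) (h₂ : Derivable Γ (t.equal u)) :
    Derivable Γ (s.equal u) := by
  have key (r : L.Term ℕ) : instantiate
      (BoundedFormula.equal (s.relabel Sum.inl) (Term.var (Sum.inr 0)) : L.BoundedFormula ℕ 1) r =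
        s.equal r := by
    rw [instantiate_eq_bsubst]
    simp [bsubst, Term.equal, Term.bdEqual, relabel_eq_subst, subst_subst]
  have := eqSubst _ h₂ ((key t).symm ▸ h₁)
  rwa [key] at this

theorem eqCongr (s : L.Term (ℕ ⊕ Unit)) {t u : L.Term ℕ} (h : Derivable Γ (t.equal u)) :
    Derivable Γ ((s.subst (Sum.elim Term.var fun _ => t)).equal
      (s.subst (Sum.elim Term.var fun _ => u))) := by
  have key (r : L.Term ℕ) : instantiate
      (BoundedFormula.equal ((s.subst (Sum.elim Term.var fun _ => t)).relabel Sum.inl)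
        (s.relabel (Sum.map id fun _ => 0)) : L.BoundedFormula ℕ 1) r =
        (s.subst (Sum.elim Term.var fun _ => t)).equal
          (s.subst (Sum.elim Term.var fun _ => r)) := by
    rw [instantiate_eq_bsubst]
    simp only [bsubst, Term.equal, Term.bdEqual, relabel_eq_subst, subst_subst]
    congr 2
    funext x
    rcases x with a | j <;> simp
  have := eqSubst _ h ((key t).symm ▸ eqRefl _)
  rwa [key] at this

end Derivable

theorem shift_ofSentence (α : L.Sentence) : shift (ofSentence α) = ofSentence α := by
  rw [shift_eq_bsubst, ofSentence_eq_bsubst, bsubst_bsubst]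
  congr 1
  funext x
  rcases x with a | j
  · exact a.elim
  · rfl

theorem shift_image_ofSentence (F : Set L.Sentence) :
    shift '' (ofSentence '' F) = ofSentence '' F := by
  simp [Set.image_image, shift_ofSentence]

theorem ofSentence_not (α : L.Sentence) : ofSentence α.not = (ofSentence α).not := by
  simp [ofSentence_eq_bsubst]

theorem realize_ofSentence {M : Type*} [L.Structure M] (α : L.Sentence) (w : ℕ → M) :
    (ofSentence α).Realize w ↔ M ⊨ α := by
  rw [ofSentence, Formula.realize_relabel, Sentence.Realize]
  congr! 1

theorem Proves.of_mem {F : Set L.Sentence} {α : L.Sentence} (h : α ∈ F) : Proves F α :=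
  .hyp ⟨α, h, rfl⟩

/-- Cut for infinitely many hypotheses: finitely many occur in the derivation, and these are cut one
at a time. -/
theorem Derivable.of_forall (h : Derivable Γ φ) (hΓ : ∀ γ ∈ Γ, Derivable Δ γ) : Derivable Δ φ := by
  obtain ⟨Γ₀, hΓ₀, hf, h₀⟩ := h.exists_finite
  clear h
  induction Γ₀, hf using Set.Finite.induction_on generalizing φ with
  | empty => exact h₀.mono (Set.empty_subset _)
  | insert _ _ ih =>
    exact .impE (ih (fun x hx => hΓ₀ (Set.mem_insert_of_mem _ hx)) (.impI h₀))
      (hΓ _ (hΓ₀ (Set.mem_insert _ _)))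

end Deduction

/-! ### Instances of formulas without free variables -/

section Instances

variable {L : FirstOrder.Language.{u, v}} {n : ℕ} {Γ : Set (L.Formula ℕ)}

/-- The formula obtained from `φ` by substituting the terms `w` for the bound variables. -/
def inst (φ : L.BoundedFormula Empty n) (w : Fin n → L.Term ℕ) : L.Formula ℕ :=
  bsubst φ (Sum.elim Empty.elim fun j => (w j).relabel Sum.inl)

/-- The term obtained from `t` by substituting the terms `w` for the bound variables. -/
def instTerm (t : L.Term (Empty ⊕ Fin n)) (w : Fin n → L.Term ℕ) : L.Term ℕ :=
  t.subst (Sum.elim Empty.elim w)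

theorem relabel_instTerm {α : Type} (t : L.Term (Empty ⊕ Fin n)) (w : Fin n → L.Term ℕ)
    (g : ℕ → α) :
    (instTerm t w).relabel g = t.subst (Sum.elim Empty.elim fun j => (w j).relabel g) := by
  rw [instTerm, relabel_subst]
  congr 1
  funext x
  rcases x with a | j
  · exact a.elim
  · rfl

theorem ofSentence_eq_inst (α : L.Sentence) : ofSentence α = inst α Fin.elim0 := by
  rw [ofSentence_eq_bsubst, inst]
  congr 1
  funext x
  rcases x with a | j
  · exact a.elim
  · exact j.elim0

@[simp]
theorem inst_imp (φ ψ : L.BoundedFormula Empty n) (w : Fin n → L.Term ℕ) :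
    inst (φ.imp ψ) w = (inst φ w).imp (inst ψ w) :=
  rfl

@[simp]
theorem inst_not (φ : L.BoundedFormula Empty n) (w : Fin n → L.Term ℕ) :
    inst φ.not w = (inst φ w).not :=
  rfl

@[simp]
theorem inst_inf (φ ψ : L.BoundedFormula Empty n) (w : Fin n → L.Term ℕ) :
    inst (φ ⊓ ψ) w = inst φ w ⊓ inst ψ w :=
  rfl

theorem inst_iff (φ ψ : L.BoundedFormula Empty n) (w : Fin n → L.Term ℕ) :
    inst (φ.iff ψ) w = (inst φ w).imp (inst ψ w) ⊓ (inst ψ w).imp (inst φ w) :=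
  rfl

@[simp]
theorem inst_equal (t u : L.Term (Empty ⊕ Fin n)) (w : Fin n → L.Term ℕ) :
    inst (.equal t u) w = (instTerm t w).equal (instTerm u w) := by
  simp only [inst, bsubst, Term.equal, Term.bdEqual, relabel_instTerm]

/-- With its companion for fresh variables, this lets the quantifier rules act on `inst φ w` by
appending a term to the tuple `w`, so that `liftSubst` no longer appears in later derivations. -/
theorem instantiate_liftSubst_inst (φ : L.BoundedFormula Empty (n + 1)) (w : Fin n → L.Term ℕ)
    (t : L.Term ℕ) :
    instantiate (bsubst φ (liftSubst (Sum.elim Empty.elim fun j => (w j).relabel Sum.inl))) t =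
      inst φ (Fin.snoc (α := fun _ => L.Term ℕ) w t) := by
  rw [instantiate_bsubst, inst]
  congr 1
  funext x
  rcases x with a | j
  · exact a.elim
  · induction j using Fin.lastCases <;> simp

theorem instantiateFresh_liftSubst_inst (φ : L.BoundedFormula Empty (n + 1))
    (w : Fin n → L.Term ℕ) :
    instantiateFresh (bsubst φ (liftSubst (Sum.elim Empty.elim fun j => (w j).relabel Sum.inl))) =
      inst φ (Fin.snoc (α := fun _ => L.Term ℕ) (fun j => (w j).relabel Nat.succ)
        (Term.var 0)) := by
  rw [instantiateFresh_bsubst, inst]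
  congr 1
  funext x
  rcases x with a | j
  · exact a.elim
  · induction j using Fin.lastCases <;> simp [Function.comp_def]

theorem ofSentence_instantiate (φ : L.BoundedFormula Empty 1) (t : L.Term Empty) :
    ofSentence (instantiate φ t) = inst φ fun _ => t.relabel Empty.elim := by
  rw [ofSentence_eq_bsubst, instantiate_eq_bsubst, inst, bsubst_bsubst]
  congr 1
  funext x
  rcases x with a | j
  · exact a.elim
  · simp [← relabel_eq_subst, Function.comp_def]

namespace Derivable

theorem inst_allE {φ : L.BoundedFormula Empty (n + 1)} {w : Fin n → L.Term ℕ}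
    (h : Derivable Γ (inst φ.all w)) (t : L.Term ℕ) :
    Derivable Γ (inst φ (Fin.snoc (α := fun _ => L.Term ℕ) w t)) := by
  rw [← instantiate_liftSubst_inst]
  exact .allE t h

theorem inst_allI {φ : L.BoundedFormula Empty (n + 1)} {w : Fin n → L.Term ℕ}
    (h : Derivable (StableTheory.shift '' Γ)
      (inst φ (Fin.snoc (α := fun _ => L.Term ℕ) (fun j => (w j).relabel Nat.succ) (Term.var 0)))) :
    Derivable Γ (inst φ.all w) := by
  rw [← instantiateFresh_liftSubst_inst] at h
  exact .allI h

theorem inst_exI {φ : L.BoundedFormula Empty (n + 1)} {w : Fin n → L.Term ℕ} (t : L.Term ℕ)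
    (h : Derivable Γ (inst φ (Fin.snoc (α := fun _ => L.Term ℕ) w t))) :
    Derivable Γ (inst φ.ex w) := by
  rw [← instantiate_liftSubst_inst] at h
  exact .exI t h

theorem inst_exE {φ : L.BoundedFormula Empty (n + 1)} {w : Fin n → L.Term ℕ} {χ : L.Formula ℕ}
    (h₁ : Derivable Γ (inst φ.ex w))
    (h₂ : Derivable (insert (inst φ (Fin.snoc (α := fun _ => L.Term ℕ)
      (fun j => (w j).relabel Nat.succ) (Term.var 0))) (StableTheory.shift '' Γ))
        (StableTheory.shift χ)) :
    Derivable Γ χ := by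
  rw [← instantiateFresh_liftSubst_inst] at h₂
  exact .exE h₁ h₂

theorem inst_eqSubst (φ : L.BoundedFormula Empty (n + 1)) {w : Fin n → L.Term ℕ} {t u : L.Term ℕ}
    (h₁ : Derivable Γ (t.equal u))
    (h₂ : Derivable Γ (inst φ (Fin.snoc (α := fun _ => L.Term ℕ) w t))) :
    Derivable Γ (inst φ (Fin.snoc (α := fun _ => L.Term ℕ) w u)) := by
  rw [← instantiate_liftSubst_inst] at h₂ ⊢
  exact .eqSubst _ h₁ h₂

end Derivable

end Instances

/-! ### Robinson arithmetic -/

namespace Arith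

section Symbols

variable {α β : Type} (t u : arith.Term α) (σ : α → arith.Term β) (g : α → β)

theorem func_succ (ts : Fin 1 → arith.Term α) :
    Term.func (L := arith) ArithFunc.succ ts = succ (ts 0) := by
  rw [succ]
  congr 1
  funext j
  fin_cases j
  rfl

theorem func_add (ts : Fin 2 → arith.Term α) :
    Term.func (L := arith) ArithFunc.add ts = add (ts 0) (ts 1) := by
  rw [add]
  congr 1
  funext j
  fin_cases j <;> rfl

theorem func_mul (ts : Fin 2 → arith.Term α) :
    Term.func (L := arith) ArithFunc.mul ts = mul (ts 0) (ts 1) := by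
  rw [mul]
  congr 1
  funext j
  fin_cases j <;> rfl

theorem func_zero (ts : Fin 0 → arith.Term α) :
    Term.func (L := arith) ArithFunc.zero ts = zero := by
  rw [zero]
  congr 1
  funext j
  exact j.elim0

@[simp]
theorem subst_zero : (zero : arith.Term α).subst σ = zero :=
  func_zero _

@[simp]
theorem subst_succ : (succ t).subst σ = succ (t.subst σ) :=
  func_succ _

@[simp]
theorem subst_add : (add t u).subst σ = add (t.subst σ) (u.subst σ) :=
  func_add _

@[simp]
theorem subst_mul : (mul t u).subst σ = mul (t.subst σ) (u.subst σ) :=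
  func_mul _

@[simp]
theorem relabel_zero : (zero : arith.Term α).relabel g = zero :=
  func_zero _

@[simp]
theorem relabel_succ : (succ t).relabel g = succ (t.relabel g) :=
  func_succ _

@[simp]
theorem relabel_add : (add t u).relabel g = add (t.relabel g) (u.relabel g) :=
  func_add _

@[simp]
theorem relabel_numeral (m : ℕ) : (numeral m : arith.Term α).relabel g = numeral m := by
  induction m with
  | zero => exact relabel_zero g
  | succ m ih => rw [numeral, relabel_succ, ih, numeral]

end Symbols

/-- The standard model. -/
instance standardModel : arith.Structure ℕ where
  funMap
    | ArithFunc.zero, _ => 0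
    | ArithFunc.succ, x => x 0 + 1
    | ArithFunc.add, x => x 0 + x 1
    | ArithFunc.mul, x => x 0 * x 1
  RelMap
    | ArithRel.lt, x => x 0 < x 1

section Realize

variable {α : Type} (t u : arith.Term α) (w : α → ℕ)

@[simp]
theorem realize_zero : (zero : arith.Term α).realize w = 0 :=
  rfl

@[simp]
theorem realize_succ : (succ t).realize w = t.realize w + 1 :=
  rfl

@[simp]
theorem realize_add : (add t u).realize w = t.realize w + u.realize w :=
  rfl

@[simp]
theorem realize_mul : (mul t u).realize w = t.realize w * u.realize w :=
  rfl

@[simp]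
theorem realize_numeral (m : ℕ) : (numeral m : arith.Term α).realize w = m := by
  induction m with
  | zero => rfl
  | succ m ih => rw [numeral, realize_succ, ih]

@[simp]
theorem realize_lt {n : ℕ} (t u : arith.Term (α ⊕ Fin n)) (x : Fin n → ℕ) :
    (lt t u).Realize w x ↔ t.realize (Sum.elim w x) < u.realize (Sum.elim w x) :=
  Iff.rfl

end Realize

theorem models_Q {α : arith.Sentence} (h : α ∈ Q) : ℕ ⊨ α := by
  simp only [Q, Set.mem_insert_iff, Set.mem_singleton_iff] at h
  rcases h with rfl | rfl | rfl | rfl | rfl | rfl | rfl | rfl <;>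
    simp only [Sentence.Realize, Formula.Realize, BoundedFormula.realize_all,
      BoundedFormula.realize_not, BoundedFormula.realize_imp, BoundedFormula.realize_bdEqual,
      BoundedFormula.realize_ex, BoundedFormula.realize_iff, realize_lt, realize_succ, realize_add,
      realize_mul, realize_zero, Function.comp, Term.realize_var, Sum.elim_inr, Fin.snoc]
  · intro a
    simp
  · intro a b
    simp
  · intro a
    simp
    omega
  · intro a
    simp
  · intro a b
    simp
    omega
  · intro a
    simp
  · intro a b
    simp
    ring
  · intro a b
    simp
    exact ⟨fun h => ⟨b - a - 1, by omega⟩, fun ⟨z, hz⟩ => by omega⟩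

theorem realize_of_Q_proves {α : arith.Sentence} (h : Proves Q α) : ℕ ⊨ α := by
  rw [← realize_ofSentence α fun _ => 0]
  refine h.sound _ ?_
  rintro _ ⟨β, hβ, rfl⟩
  exact (realize_ofSentence β _).2 (models_Q hβ)

/-- The formula `t < u`. -/
def ltFormula (t u : arith.Term ℕ) : arith.Formula ℕ :=
  lt (t.relabel Sum.inl) (u.relabel Sum.inl)

theorem inst_lt {n : ℕ} (t u : arith.Term (Empty ⊕ Fin n)) (w : Fin n → arith.Term ℕ) :
    inst (lt t u) w = ltFormula (instTerm t w) (instTerm u w) := by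
  simp only [inst, lt, ltFormula, bsubst, relabel_instTerm]
  congr 1
  funext j
  fin_cases j <;> rfl

@[simp]
theorem shift_equal {L : FirstOrder.Language.{u, v}} (t u : L.Term ℕ) :
    shift (t.equal u) = (t.relabel Nat.succ).equal (u.relabel Nat.succ) := by
  simp [shift_eq_bsubst, Term.equal, Term.bdEqual, bsubst, relabel_eq_subst, subst_subst]

/-! ### Consequences of the axioms of `Q` as derived rules -/

section Theory

variable {Γ : Set (arith.Formula ℕ)} {s t u : arith.Term ℕ} {χ : arith.Formula ℕ}

/-- The axioms of Robinson arithmetic are among the formulas in `Γ`. -/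
def ContainsQ (Γ : Set (arith.Formula ℕ)) : Prop :=
  ofSentence '' Q ⊆ Γ

theorem ContainsQ.insert (h : ContainsQ Γ) : ContainsQ (insert χ Γ) :=
  h.trans (Set.subset_insert _ _)

theorem ContainsQ.shift (h : ContainsQ Γ) : ContainsQ (shift '' Γ) := by
  have := Set.image_mono (f := StableTheory.shift) h
  rwa [shift_image_ofSentence] at this

theorem ContainsQ.derivable_of_mem_Q (h : ContainsQ Γ) {α : arith.Sentence} (hα : α ∈ Q) :
    Derivable Γ (inst α Fin.elim0) := by
  rw [← ofSentence_eq_inst]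
  exact .hyp (h ⟨α, hα, rfl⟩)

theorem succ_ne_zero (h : ContainsQ Γ) (t : arith.Term ℕ) :
    Derivable Γ ((succ t).equal zero).not := by
  have := (h.derivable_of_mem_Q (α := ∀' ∼(succ (&0) =' zero)) (by simp [Q])).inst_allE t
  simpa [Term.bdEqual, instTerm, Fin.snoc] using this

theorem succ_inj (h : ContainsQ Γ) (ht : Derivable Γ ((succ t).equal (succ u))) :
    Derivable Γ (t.equal u) := by
  have := ((h.derivable_of_mem_Q (α := ∀' ∀' ((succ (&0) =' succ (&1)) ⟹ (&0 =' &1)))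
    (by simp [Q])).inst_allE t).inst_allE u
  simp only [inst_imp, Term.bdEqual, inst_equal] at this
  exact .impE (by simpa [instTerm, Fin.snoc] using this) ht

/-- The third axiom as a case distinction, with the eigenvariable `0` as predecessor of `t`. It is
the substitute for induction inside `Q`. -/
theorem zero_or_succ (h : ContainsQ Γ) (h₀ : Derivable (insert (t.equal zero) Γ) χ)
    (h₁ : Derivable (insert ((t.relabel Nat.succ).equal (succ (Term.var 0))) (shift '' Γ))
      (shift χ)) : Derivable Γ χ := by
  have := (h.derivable_of_mem_Q (α := ∀' (∼(&0 =' zero) ⟹ ∃' (&0 =' succ (&1)))) (by simp [Q])).inst_allE t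
  simp only [inst_imp, inst_not, Term.bdEqual, inst_equal] at this
  refine .byCases h₀ (.inst_exE (.impE this.weaken (.hyp ?_)) (h₁.mono ?_))
  · left
    simp [instTerm, Fin.snoc]
  · refine Set.insert_subset (Or.inl ?_) ((Set.image_mono (Set.subset_insert _ _)).trans
      (Set.subset_insert _ _))
    simp [instTerm, Fin.snoc]

theorem add_zero (h : ContainsQ Γ) (t : arith.Term ℕ) : Derivable Γ ((add t zero).equal t) := by
  have := (h.derivable_of_mem_Q (α := ∀' (add (&0) zero =' &0)) (by simp [Q])).inst_allE t
  simpa [Term.bdEqual, instTerm, Fin.snoc] using this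

theorem add_succ (h : ContainsQ Γ) (t u : arith.Term ℕ) :
    Derivable Γ ((add t (succ u)).equal (succ (add t u))) := by
  have := ((h.derivable_of_mem_Q (α := ∀' ∀' (add (&0) (succ (&1)) =' succ (add (&0) (&1))))
    (by simp [Q])).inst_allE t).inst_allE u
  simpa [Term.bdEqual, instTerm, Fin.snoc] using this

theorem mul_zero (h : ContainsQ Γ) (t : arith.Term ℕ) :
    Derivable Γ ((mul t zero).equal zero) := by
  have := (h.derivable_of_mem_Q (α := ∀' (mul (&0) zero =' zero)) (by simp [Q])).inst_allE t
  simpa [Term.bdEqual, instTerm, Fin.snoc] using this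

theorem mul_succ (h : ContainsQ Γ) (t u : arith.Term ℕ) :
    Derivable Γ ((mul t (succ u)).equal (add (mul t u) t)) := by
  have := ((h.derivable_of_mem_Q (α := ∀' ∀' (mul (&0) (succ (&1)) =' add (mul (&0) (&1)) (&0)))
    (by simp [Q])).inst_allE t).inst_allE u
  simpa [Term.bdEqual, instTerm, Fin.snoc] using this

theorem lt_intro (h : ContainsQ Γ) (s : arith.Term ℕ)
    (hs : Derivable Γ ((add (succ s) t).equal u)) : Derivable Γ (ltFormula t u) := by
  have := ((h.derivable_of_mem_Q (α := ∀' ∀' (lt (&0) (&1) ⇔ ∃' (add (succ (&2)) (&0) =' &1)))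
    (by simp [Q])).inst_allE t).inst_allE u
  simp only [inst_iff, inst_lt] at this
  exact .impE (.andRight this)
    (.inst_exI s (by simpa [Term.bdEqual, instTerm, Fin.snoc] using hs))

theorem lt_elim (h : ContainsQ Γ) (hs : Derivable Γ (ltFormula t u))
    (hχ : Derivable (insert ((add (succ (Term.var 0)) (t.relabel Nat.succ)).equal
      (u.relabel Nat.succ)) (shift '' Γ)) (shift χ)) : Derivable Γ χ := by
  have := ((h.derivable_of_mem_Q (α := ∀' ∀' (lt (&0) (&1) ⇔ ∃' (add (succ (&2)) (&0) =' &1)))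
    (by simp [Q])).inst_allE t).inst_allE u
  simp only [inst_iff, inst_lt] at this
  refine .inst_exE (.impE (.andLeft this) hs) (hχ.mono ?_)
  · refine Set.insert_subset (Or.inl ?_) (Set.subset_insert _ _)
    simp [Term.bdEqual, instTerm, Fin.snoc]

end Theory

end Arith

/-! ### `Σ⁰₀` completeness of Robinson arithmetic -/

namespace Arith

section Theory

variable {Γ : Set (arith.Formula ℕ)} {s t u : arith.Term ℕ} {χ : arith.Formula ℕ}

theorem succ_congr (h : Derivable Γ (t.equal u)) : Derivable Γ ((succ t).equal (succ u)) := by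
  have := Derivable.eqCongr (succ (Term.var (Sum.inr ()))) h
  simpa using this

theorem add_congr {t' u' : arith.Term ℕ} (ht : Derivable Γ (t.equal t'))
    (hu : Derivable Γ (u.equal u')) : Derivable Γ ((add t u).equal (add t' u')) := by
  have h₁ := Derivable.eqCongr (add (Term.var (Sum.inr ())) (u.relabel Sum.inl)) ht
  have h₂ := Derivable.eqCongr (add (t'.relabel Sum.inl) (Term.var (Sum.inr ()))) hu
  simp only [subst_add, subst_relabel, Term.subst, Sum.elim_inr, Sum.elim_comp_inl,
    subst_var] at h₁ h₂
  exact h₁.eqTrans h₂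

theorem mul_congr {t' u' : arith.Term ℕ} (ht : Derivable Γ (t.equal t'))
    (hu : Derivable Γ (u.equal u')) : Derivable Γ ((mul t u).equal (mul t' u')) := by
  have h₁ := Derivable.eqCongr (mul (Term.var (Sum.inr ())) (u.relabel Sum.inl)) ht
  have h₂ := Derivable.eqCongr (mul (t'.relabel Sum.inl) (Term.var (Sum.inr ()))) hu
  simp only [subst_mul, subst_relabel, Term.subst, Sum.elim_inr, Sum.elim_comp_inl,
    subst_var] at h₁ h₂
  exact h₁.eqTrans h₂

theorem add_numeral (h : ContainsQ Γ) (m n : ℕ) :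
    Derivable Γ ((add (numeral m) (numeral n)).equal (numeral (m + n))) := by
  induction n with
  | zero => exact add_zero h _
  | succ n ih => exact (add_succ h _ _).eqTrans (succ_congr ih)

theorem mul_numeral (h : ContainsQ Γ) (m n : ℕ) :
    Derivable Γ ((mul (numeral m) (numeral n)).equal (numeral (m * n))) := by
  induction n with
  | zero => exact mul_zero h _
  | succ n ih =>
    exact (mul_succ h _ _).eqTrans ((add_congr ih (.eqRefl _)).eqTrans (add_numeral h _ _))

theorem numeral_ne (h : ContainsQ Γ) {m n : ℕ} (hmn : m ≠ n) :
    Derivable Γ ((numeral m).equal (numeral n)).not := by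
  induction m generalizing n with
  | zero =>
    cases n with
    | zero => exact absurd rfl hmn
    | succ n => exact .notI (.notE (succ_ne_zero h.insert _) (Derivable.head.eqSymm))
  | succ m ih =>
    cases n with
    | zero => exact succ_ne_zero h _
    | succ n =>
      exact .notI (.notE (ih fun h => hmn (congrArg _ h)).weaken (succ_inj h.insert .head))

theorem instTerm_numeral (h : ContainsQ Γ) {n : ℕ} (t : arith.Term (Empty ⊕ Fin n))
    (w : Fin n → ℕ) :
    Derivable Γ ((instTerm t fun j => numeral (w j)).equal
      (numeral (t.realize (Sum.elim default w)))) := by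
  induction t with
  | var x =>
    rcases x with a | j
    · exact a.elim
    · exact .eqRefl _
  | func f ts ih =>
    cases f with
    | zero =>
      rw [func_zero]
      simp only [instTerm, subst_zero]
      exact .eqRefl _
    | succ =>
      rw [func_succ]
      simp only [instTerm, subst_succ]
      exact succ_congr (ih 0)
    | add =>
      rw [func_add]
      simp only [instTerm, subst_add]
      exact (add_congr (ih 0) (ih 1)).eqTrans (add_numeral h _ _)
    | mul =>
      rw [func_mul]
      simp only [instTerm, subst_mul]
      exact (mul_congr (ih 0) (ih 1)).eqTrans (mul_numeral h _ _)

/-- `s u + t = n` forces `t` to be one of the numerals below `n`. The induction on `n` is external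
and peels successors off `t`, the argument on which addition recurs. Each step moves to a shifted
context, whence the generalization over `Γ`. -/
theorem cases_of_add_eq_numeral (h : ContainsQ Γ) {n : ℕ}
    (ht : Derivable Γ ((add (succ u) t).equal (numeral n)))
    (hχ : ∀ j < n, Derivable Γ ((t.equal (numeral j)).imp χ)) : Derivable Γ χ := by
  induction n generalizing Γ t u χ with
  | zero =>
    refine zero_or_succ (t := t) h (.notE (succ_ne_zero h.insert u) ?_) ?_
    · exact ((add_zero h.insert _).eqSymm.eqTrans
        (add_congr (.eqRefl _) Derivable.head.eqSymm)).eqTrans ht.weaken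
    · have h' : ContainsQ (insert ((t.relabel Nat.succ).equal (succ (Term.var 0)))
        (shift '' Γ)) := h.shift.insert
      refine .notE (succ_ne_zero h' (add (succ (u.relabel Nat.succ)) (Term.var 0))) ?_
      have := ht.shift
      simp only [shift_equal, relabel_add, relabel_succ, relabel_numeral] at this
      exact ((add_succ h' _ _).eqSymm.eqTrans
        (add_congr (.eqRefl _) Derivable.head.eqSymm)).eqTrans this.weaken
  | succ n ih =>
    refine zero_or_succ (t := t) h (.impE (hχ 0 n.succ_pos).weaken .head) ?_
    have h' : ContainsQ (insert ((t.relabel Nat.succ).equal (succ (Term.var 0)))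
        (shift '' Γ)) := h.shift.insert
    -- For `t = s y` the equation becomes `s u + y = n`; here `y` is the variable `0`, and `y = j`
    -- means `t = j + 1`.
    refine ih (t := Term.var 0) (u := u.relabel Nat.succ) h' (succ_inj h' ?_) fun j hj => .impI ?_
    · have := ht.shift
      simp only [shift_equal, relabel_add, relabel_succ, relabel_numeral] at this
      exact ((add_succ h' _ _).eqSymm.eqTrans
        (add_congr (.eqRefl _) Derivable.head.eqSymm)).eqTrans this.weaken
    · have : Derivable (shift '' Γ)
          (((t.relabel Nat.succ).equal (numeral (j + 1))).imp (shift χ)) := by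
        have := (hχ (j + 1) (Nat.succ_lt_succ hj)).shift
        have key : shift ((t.equal (numeral (j + 1))).imp χ) =
          (shift (t.equal (numeral (j + 1)))).imp (shift χ) := rfl
        rwa [key, shift_equal, relabel_numeral] at this
      exact .impE this.weaken.weaken (Derivable.head.weaken.eqTrans (succ_congr .head))

theorem cases_of_lt_numeral (h : ContainsQ Γ) {n : ℕ} (ht : Derivable Γ (ltFormula t u))
    (hu : Derivable Γ (u.equal (numeral n)))
    (hχ : ∀ j < n, Derivable (insert (t.equal (numeral j)) Γ) χ) : Derivable Γ χ := by
  refine lt_elim h ht ?_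
  refine cases_of_add_eq_numeral (t := t.relabel Nat.succ) (u := Term.var 0) (n := n)
    h.shift.insert ?_ fun j hj => ?_
  · have := hu.shift
    rw [shift_equal, relabel_numeral] at this
    exact Derivable.head.eqTrans this.weaken
  · have := (Derivable.impI (hχ j hj)).shift
    have key : shift ((t.equal (numeral j)).imp χ) =
      (shift (t.equal (numeral j))).imp (shift χ) := rfl
    rw [key, shift_equal, relabel_numeral] at this
    exact this.weaken

theorem lt_of_numeral (h : ContainsQ Γ) {m n : ℕ} (hmn : m < n)
    (ht : Derivable Γ (t.equal (numeral m))) (hu : Derivable Γ (u.equal (numeral n))) :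
    Derivable Γ (ltFormula t u) := by
  -- The axiom for `<` asks for `z` with `s z + m = n`.
  refine lt_intro h (numeral (n - m - 1)) ?_
  refine (add_congr (t' := numeral (n - m)) ?_ ht).eqTrans ((add_numeral h _ _).eqTrans ?_)
  · obtain ⟨k, hk⟩ : ∃ k, n - m = k + 1 := ⟨n - m - 1, by omega⟩
    rw [hk]
    exact .eqRefl _
  · rw [Nat.sub_add_cancel hmn.le]
    exact hu.eqSymm

end Theory

/-! ### `Q` decides the numerical instances of `Σ⁰₀` formulas -/

section Completeness

variable {n : ℕ}

theorem snoc_numeral (w : Fin n → ℕ) (m : ℕ) :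
    (Fin.snoc (α := fun _ => arith.Term ℕ) (fun j => numeral (w j)) (numeral m)) =
      fun j => numeral (Fin.snoc (α := fun _ => ℕ) w m j) := by
  funext j
  induction j using Fin.lastCases <;> simp

theorem inst_lastLt (t : arith.Term (Empty ⊕ Fin n)) (w : Fin n → arith.Term ℕ)
    (s : arith.Term ℕ) :
    inst (lastLt t) (Fin.snoc (α := fun _ => arith.Term ℕ) w s) = ltFormula s (instTerm t w) := by
  rw [lastLt, inst_lt]
  congr 1
  · simp [instTerm]
  · rw [instTerm, subst_relabel, instTerm]
    congr 1
    funext x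
    rcases x with a | j
    · rfl
    · simp

theorem realize_lastLt (t : arith.Term (Empty ⊕ Fin n)) (w : Fin n → ℕ) (m : ℕ) :
    (lastLt t).Realize default (Fin.snoc (α := fun _ => ℕ) w m) ↔
      m < t.realize (Sum.elim default w) := by
  rw [lastLt, realize_lt, Term.realize_relabel]
  have : Sum.elim default (Fin.snoc (α := fun _ => ℕ) w m) ∘ Sum.map id Fin.castSucc =
      (Sum.elim default w : Empty ⊕ Fin n → ℕ) := by
    funext x
    rcases x with a | j
    · rfl
    · simp
  rw [this]
  simp

/-- Provability of the true and refutability of the false instances are proved together, because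
implication is contravariant in its premise. Terms are evaluated in `Q`, and a bounded quantifier is
reduced to the finitely many numerals below its bound by `cases_of_lt_numeral`. -/
theorem sigmaZero_decided {φ : arith.BoundedFormula Empty n} (hφ : IsSigmaZero φ) (w : Fin n → ℕ) :
    (φ.Realize default w → Derivable (ofSentence '' Q) (inst φ fun j => numeral (w j))) ∧
      (¬ φ.Realize default w →
        Derivable (ofSentence '' Q) (inst φ fun j => numeral (w j)).not) := by
  have hQ : ContainsQ (ofSentence '' Q) := Set.Subset.rfl
  -- `hmem` and `hmem'` exchange the instance at the numeral `m` with the instance at the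
  -- eigenvariable `0`, given that the two are equal.
  have hmem {n : ℕ} (φ : arith.BoundedFormula Empty (n + 1)) (w : Fin n → ℕ) (m : ℕ)
      (Γ : Set (arith.Formula ℕ)) :
      Derivable (insert ((Term.var 0 : arith.Term ℕ).equal (numeral m)) Γ)
        ((inst φ fun j => numeral (Fin.snoc (α := fun _ => ℕ) w m j)).imp (inst φ (Fin.snoc
          (α := fun _ => arith.Term ℕ) (fun j => (numeral (w j)).relabel Nat.succ)
            (Term.var 0)))) := by
    simp only [relabel_numeral, ← snoc_numeral]
    exact .impI (.inst_eqSubst φ Derivable.head.weaken.eqSymm .head)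
  have hmem' {n : ℕ} (φ : arith.BoundedFormula Empty (n + 1)) (w : Fin n → ℕ) (m : ℕ)
      (Γ : Set (arith.Formula ℕ)) :
      Derivable (insert ((Term.var 0 : arith.Term ℕ).equal (numeral m)) Γ)
        ((inst φ (Fin.snoc (α := fun _ => arith.Term ℕ)
          (fun j => (numeral (w j)).relabel Nat.succ) (Term.var 0))).imp
            (inst φ fun j => numeral (Fin.snoc (α := fun _ => ℕ) w m j))) := by
    simp only [relabel_numeral, ← snoc_numeral]
    exact .impI (.inst_eqSubst φ Derivable.head.weaken .head)
  induction hφ with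
  | falsum => exact ⟨fun h => h.elim, fun _ => .notI .head⟩
  | equal t u =>
    simp only [inst_equal]
    refine ⟨fun h => ?_, fun h => .notI (.notE (numeral_ne hQ.insert h) ?_)⟩
    · have := instTerm_numeral hQ u w
      rw [show u.realize (Sum.elim default w) = _ from h.symm] at this
      exact (instTerm_numeral hQ t w).eqTrans this.eqSymm
    · exact ((instTerm_numeral hQ.insert t w).eqSymm.eqTrans .head).eqTrans
        (instTerm_numeral hQ.insert u w)
  | lt t u =>
    simp only [inst_lt, realize_lt]
    refine ⟨fun h => lt_of_numeral hQ h (instTerm_numeral hQ t w) (instTerm_numeral hQ u w),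
      fun h => .notI (cases_of_lt_numeral hQ.insert .head (instTerm_numeral hQ.insert u w)
        fun j hj => .notE (numeral_ne hQ.insert.insert ?_)
          ((instTerm_numeral hQ.insert.insert t w).eqSymm.eqTrans .head))⟩
    omega
  | @imp n φ ψ _ _ ih₁ ih₂ =>
    simp only [inst_imp, BoundedFormula.realize_imp]
    refine ⟨fun h => ?_, fun h => ?_⟩
    · by_cases h₁ : φ.Realize default w
      · exact .impI ((ih₂ w).1 (h h₁)).weaken
      · exact .impI (.notE ((ih₁ w).2 h₁).weaken .head)
    · push Not at h
      exact .notI (.notE ((ih₂ w).2 h.2).weaken (.impE .head ((ih₁ w).1 h.1).weaken))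
  | @ball n t φ _ ih =>
    simp only [BoundedFormula.realize_all, BoundedFormula.realize_imp, realize_lastLt]
    refine ⟨fun h => .inst_allI ?_, fun h => .notI ?_⟩
    · rw [shift_image_ofSentence, inst_imp, inst_lastLt]
      simp only [relabel_numeral]
      refine .impI (cases_of_lt_numeral hQ.insert .head (instTerm_numeral hQ.insert t w)
        fun j hj => ?_)
      have := hmem φ w j (insert (ltFormula (Term.var 0)
        (instTerm t fun j => numeral (w j))) (ofSentence '' Q))
      simp only [relabel_numeral] at this
      exact .impE this ((ih _).1 (h j hj)).weaken.weaken
    · push Not at h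
      obtain ⟨m, hm, h⟩ := h
      have := Derivable.inst_allE (φ := (lastLt t).imp φ) (w := fun j => numeral (w j))
        (Derivable.head (Γ := ofSentence '' Q)) (numeral m)
      rw [inst_imp, inst_lastLt, snoc_numeral] at this
      exact .notE ((ih _).2 h).weaken (.impE this
        (lt_of_numeral hQ.insert hm (.eqRefl _) (instTerm_numeral hQ.insert t w)))
  | @bex n t φ _ ih =>
    simp only [BoundedFormula.realize_ex, BoundedFormula.realize_inf, realize_lastLt]
    refine ⟨fun ⟨m, hm, h⟩ => .inst_exI (numeral m) ?_, fun h => .notI (.inst_exE .head ?_)⟩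
    · rw [inst_inf, inst_lastLt, snoc_numeral]
      exact .andI (lt_of_numeral hQ hm (.eqRefl _) (instTerm_numeral hQ t w)) ((ih _).1 h)
    · rw [inst_inf, inst_lastLt]
      simp only [relabel_numeral]
      have hQ' := (hQ.insert (χ := inst (lastLt t ⊓ φ).ex fun j => numeral (w j))).shift
      refine cases_of_lt_numeral (hQ'.insert) (Derivable.andLeft .head)
        (instTerm_numeral hQ'.insert t w) fun j hj => ?_
      have := hmem' φ w j
      simp only [relabel_numeral] at this
      refine .notE (((ih _).2 fun h' => h ⟨j, hj, h'⟩).mono (hQ'.insert.insert))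
        (.impE (this _) (Derivable.andRight .head).weaken)

theorem Q_proves_of_realize {φ : arith.BoundedFormula Empty 1} (hφ : IsSigmaZero φ) {m : ℕ}
    (h : φ.Realize default fun _ => m) : Proves Q (instantiate φ (numeral m)) := by
  rw [Proves, ofSentence_instantiate, relabel_numeral]
  exact (sigmaZero_decided hφ fun _ => m).1 h

theorem realize_of_Q_proves_instantiate {φ : arith.BoundedFormula Empty 1} {m : ℕ}
    (h : Proves Q (instantiate φ (numeral m))) : φ.Realize default fun _ => m := by
  have := realize_of_Q_proves h
  rw [Sentence.Realize, instantiate, Formula.Realize, BoundedFormula.realize_subst,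
    ← Formula.Realize, BoundedFormula.realize_toFormula] at this
  convert this using 1
  funext j
  simp

end Completeness

end Arith

/-! ### Enumeration and evaluation of `Σ⁰₀` formulas -/

namespace Arith

/-- A nonzero tag makes the payload strictly smaller, so recursion is allowed. Under tag `0` this
fails, as in `Nat.pair 0 1 = 1`; that tag is therefore reserved for leaves. -/
theorem unpair_lt {k : ℕ} (h : k.unpair.1 ≠ 0) :
    k.unpair.2 < k ∧ k.unpair.2.unpair.1 < k ∧ k.unpair.2.unpair.2 < k := by
  have h₁ : k.unpair.2 < k := by
    have := Nat.add_le_pair k.unpair.1 k.unpair.2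
    rw [Nat.pair_unpair] at this
    omega
  exact ⟨h₁, (Nat.unpair_left_le _).trans_lt h₁, (Nat.unpair_right_le _).trans_lt h₁⟩

/-- An enumeration of the terms with `n` variables. -/
def decodeTerm (n k : ℕ) : arith.Term (Empty ⊕ Fin n) :=
  if _h : k.unpair.1 = 0 then
    if hr : k.unpair.2 < n then Term.var (Sum.inr ⟨k.unpair.2, hr⟩) else zero
  else if k.unpair.1 = 1 then zero
  else if k.unpair.1 = 2 then succ (decodeTerm n k.unpair.2)
  else if k.unpair.1 = 3 then
    add (decodeTerm n k.unpair.2.unpair.1) (decodeTerm n k.unpair.2.unpair.2)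
  else mul (decodeTerm n k.unpair.2.unpair.1) (decodeTerm n k.unpair.2.unpair.2)
termination_by k
decreasing_by all_goals first
  | exact (unpair_lt _h).1
  | exact (unpair_lt _h).2.1
  | exact (unpair_lt _h).2.2

/-- An enumeration of the `Σ⁰₀` formulas with `n` variables. -/
def decodeFormula (n k : ℕ) : arith.BoundedFormula Empty n :=
  if _h : k.unpair.1 = 0 then .falsum
  else if k.unpair.1 = 1 then
    .equal (decodeTerm n k.unpair.2.unpair.1) (decodeTerm n k.unpair.2.unpair.2)
  else if k.unpair.1 = 2 then
    lt (decodeTerm n k.unpair.2.unpair.1) (decodeTerm n k.unpair.2.unpair.2)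
  else if k.unpair.1 = 3 then
    (decodeFormula n k.unpair.2.unpair.1).imp (decodeFormula n k.unpair.2.unpair.2)
  else if k.unpair.1 = 4 then
    ((lastLt (decodeTerm n k.unpair.2.unpair.1)).imp
      (decodeFormula (n + 1) k.unpair.2.unpair.2)).all
  else (lastLt (decodeTerm n k.unpair.2.unpair.1) ⊓ decodeFormula (n + 1) k.unpair.2.unpair.2).ex
termination_by k
decreasing_by all_goals first
  | exact (unpair_lt _h).2.1
  | exact (unpair_lt _h).2.2

theorem exists_decodeTerm {n : ℕ} (t : arith.Term (Empty ⊕ Fin n)) :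
    ∃ k, decodeTerm n k = t := by
  induction t with
  | var x =>
    rcases x with a | j
    · exact a.elim
    · exact ⟨Nat.pair 0 j, by rw [decodeTerm]; simp⟩
  | func f ts ih =>
    choose g hg using ih
    cases f with
    | zero => exact ⟨Nat.pair 1 0, by rw [decodeTerm, func_zero]; simp⟩
    | succ => exact ⟨Nat.pair 2 (g 0), by rw [decodeTerm, func_succ]; simp [hg]⟩
    | add => exact ⟨Nat.pair 3 (Nat.pair (g 0) (g 1)), by rw [decodeTerm, func_add]; simp [hg]⟩
    | mul => exact ⟨Nat.pair 4 (Nat.pair (g 0) (g 1)), by rw [decodeTerm, func_mul]; simp [hg]⟩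

theorem exists_decodeFormula {n : ℕ} {φ : arith.BoundedFormula Empty n} (h : IsSigmaZero φ) :
    ∃ k, decodeFormula n k = φ := by
  induction h with
  | falsum => exact ⟨Nat.pair 0 0, by rw [decodeFormula]; simp⟩
  | equal t u =>
    obtain ⟨a, rfl⟩ := exists_decodeTerm t
    obtain ⟨b, rfl⟩ := exists_decodeTerm u
    exact ⟨Nat.pair 1 (Nat.pair a b), by rw [decodeFormula]; simp⟩
  | lt t u =>
    obtain ⟨a, rfl⟩ := exists_decodeTerm t
    obtain ⟨b, rfl⟩ := exists_decodeTerm u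
    exact ⟨Nat.pair 2 (Nat.pair a b), by rw [decodeFormula]; simp⟩
  | imp _ _ ih₁ ih₂ =>
    obtain ⟨a, rfl⟩ := ih₁
    obtain ⟨b, rfl⟩ := ih₂
    exact ⟨Nat.pair 3 (Nat.pair a b), by rw [decodeFormula]; simp⟩
  | ball t _ ih =>
    obtain ⟨a, rfl⟩ := exists_decodeTerm t
    obtain ⟨b, rfl⟩ := ih
    exact ⟨Nat.pair 4 (Nat.pair a b), by rw [decodeFormula]; simp⟩
  | bex t _ ih =>
    obtain ⟨a, rfl⟩ := exists_decodeTerm t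
    obtain ⟨b, rfl⟩ := ih
    exact ⟨Nat.pair 5 (Nat.pair a b), by rw [decodeFormula]; simp⟩

theorem isSigmaZero_decodeFormula (n k : ℕ) : IsSigmaZero (decodeFormula n k) := by
  induction k using Nat.strong_induction_on generalizing n with
  | _ k ih =>
    rw [decodeFormula]
    split_ifs with h
    · exact .falsum
    · exact .equal _ _
    · exact .lt _ _
    · exact .imp (ih _ (unpair_lt h).2.1 _) (ih _ (unpair_lt h).2.2 _)
    · exact .ball _ (ih _ (unpair_lt h).2.2 _)
    · exact .bex _ (ih _ (unpair_lt h).2.2 _)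

open Primrec in
theorem primrec_tag_ite {α σ : Type*} [Primcodable α] [Primcodable σ] {k : α → ℕ} (c : ℕ)
    {f g : α → σ} (hk : Primrec k) (hf : Primrec f) (hg : Primrec g) :
    Primrec fun a => if (k a).unpair.1 = c then f a else g a :=
  .ite (Primrec.eq.comp (fst.comp (unpair.comp hk)) (.const c)) hf hg

-- Course-of-values recursion on the index. One list of calls serves all nonzero tags: the payload
-- and its two halves, whose values are the entries `0`, `1`, `2` of `x.2`.
open Primrec in
theorem primrec_termCode_decodeTerm :
    Primrec fun p : ℕ × ℕ => termCode (decodeTerm p.1 p.2) := by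
  have hr : Primrec fun x : (ℕ × ℕ) × List ℕ => x.1.2.unpair.2 :=
    snd.comp (unpair.comp (snd.comp fst))
  have hv (j : ℕ) : Primrec fun x : (ℕ × ℕ) × List ℕ => x.2.getD j 0 :=
    (list_getD 0).comp snd (.const j)
  have hpair {f g : (ℕ × ℕ) × List ℕ → ℕ} (hf : Primrec f) (hg : Primrec g) :
      Primrec fun x => Nat.pair (f x) (g x) := Primrec₂.natPair.comp hf hg
  have hq : Primrec fun p : ℕ × ℕ => if p.2.unpair.1 = 0 then [] else
      [(p.1, p.2.unpair.2), (p.1, p.2.unpair.2.unpair.1), (p.1, p.2.unpair.2.unpair.2)] := by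
    have hr : Primrec fun p : ℕ × ℕ => p.2.unpair.2 := snd.comp (unpair.comp snd)
    refine primrec_tag_ite 0 snd (.const _) (list_cons.comp (fst.pair hr) (list_cons.comp
      (fst.pair (fst.comp (unpair.comp hr))) (list_cons.comp
        (fst.pair (snd.comp (unpair.comp hr))) (.const _))))
  have hg : Primrec fun x : (ℕ × ℕ) × List ℕ => some (
      if x.1.2.unpair.1 = 0 then
        if x.1.2.unpair.2 < x.1.1 then Nat.pair 0 x.1.2.unpair.2 else Nat.pair 1 0
      else if x.1.2.unpair.1 = 1 then Nat.pair 1 0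
      else if x.1.2.unpair.1 = 2 then Nat.pair 2 (x.2.getD 0 0)
      else if x.1.2.unpair.1 = 3 then Nat.pair 3 (Nat.pair (x.2.getD 1 0) (x.2.getD 2 0))
      else Nat.pair 4 (Nat.pair (x.2.getD 1 0) (x.2.getD 2 0))) := by
    have hk : Primrec fun x : (ℕ × ℕ) × List ℕ => x.1.2 := snd.comp fst
    exact option_some.comp (primrec_tag_ite 0 hk
      (.ite (nat_lt.comp hr (fst.comp fst)) (hpair (.const 0) hr) (.const _))
      (primrec_tag_ite 1 hk (.const _) (primrec_tag_ite 2 hk (hpair (.const 2) (hv 0))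
        (primrec_tag_ite 3 hk (hpair (.const 3) (hpair (hv 1) (hv 2)))
          (hpair (.const 4) (hpair (hv 1) (hv 2)))))))
  refine nat_omega_rec' _ (m := Prod.snd) snd hq hg.to₂ ?_ ?_
  · rintro ⟨n, k⟩ p hp
    dsimp only at hp
    split_ifs at hp with h
    · simp at hp
    · have := unpair_lt h
      simp at hp
      rcases hp with rfl | rfl | rfl <;> simp [this]
  · rintro ⟨n, k⟩
    dsimp only
    conv_rhs => rw [decodeTerm]
    split_ifs <;> simp [termCode, zero, succ, add, mul]

/-- The value of the `k`-th term, the variables being interpreted by the list `l`. -/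
def termValue (l : List ℕ) (k : ℕ) : ℕ :=
  (decodeTerm l.length k).realize (Sum.elim default l.get)

open Primrec in
theorem primrec_termValue : Primrec₂ termValue := by
  have hr : Primrec fun x : (List ℕ × ℕ) × List ℕ => x.1.2.unpair.2 :=
    snd.comp (unpair.comp (snd.comp fst))
  have hv (j : ℕ) : Primrec fun x : (List ℕ × ℕ) × List ℕ => x.2.getD j 0 :=
    (list_getD 0).comp snd (.const j)
  have hq : Primrec fun p : List ℕ × ℕ => if p.2.unpair.1 = 0 then [] else
      [(p.1, p.2.unpair.2), (p.1, p.2.unpair.2.unpair.1), (p.1, p.2.unpair.2.unpair.2)] := by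
    have hr : Primrec fun p : List ℕ × ℕ => p.2.unpair.2 := snd.comp (unpair.comp snd)
    refine primrec_tag_ite 0 snd (.const _) (list_cons.comp (fst.pair hr) (list_cons.comp
      (fst.pair (fst.comp (unpair.comp hr))) (list_cons.comp
        (fst.pair (snd.comp (unpair.comp hr))) (.const _))))
  have hg : Primrec fun x : (List ℕ × ℕ) × List ℕ => some (
      -- The default `0` matches `decodeTerm`, which turns a variable out of range into the term
      -- `zero`.
      if x.1.2.unpair.1 = 0 then x.1.1.getD x.1.2.unpair.2 0
      else if x.1.2.unpair.1 = 1 then 0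
      else if x.1.2.unpair.1 = 2 then Nat.succ (x.2.getD 0 0)
      else if x.1.2.unpair.1 = 3 then x.2.getD 1 0 + x.2.getD 2 0
      else x.2.getD 1 0 * x.2.getD 2 0) := by
    have hk : Primrec fun x : (List ℕ × ℕ) × List ℕ => x.1.2 := snd.comp fst
    exact option_some.comp (primrec_tag_ite 0 hk ((list_getD 0).comp (fst.comp fst) hr)
      (primrec_tag_ite 1 hk (.const _) (primrec_tag_ite 2 hk (Primrec.succ.comp (hv 0))
        (primrec_tag_ite 3 hk (nat_add.comp (hv 1) (hv 2)) (nat_mul.comp (hv 1) (hv 2))))))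
  refine nat_omega_rec' (Function.uncurry termValue) (m := Prod.snd) snd hq hg.to₂ ?_ ?_
  · rintro ⟨n, k⟩ p hp
    dsimp only at hp
    split_ifs at hp with h
    · simp at hp
    · have := unpair_lt h
      simp at hp
      rcases hp with rfl | rfl | rfl <;> simp [this]
  · rintro ⟨l, k⟩
    dsimp only [Function.uncurry]
    conv_rhs => rw [termValue, decodeTerm]
    split_ifs with h₀ h₁ <;> simp_all [termValue]

open Primrec in
theorem primrec_code_decodeFormula :
    Primrec fun p : ℕ × ℕ => code (decodeFormula p.1 p.2) := by
  have hr : Primrec fun x : (ℕ × ℕ) × List ℕ => x.1.2.unpair.2 :=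
    snd.comp (unpair.comp (snd.comp fst))
  have hv (j : ℕ) : Primrec fun x : (ℕ × ℕ) × List ℕ => x.2.getD j 0 :=
    (list_getD 0).comp snd (.const j)
  have hpair {f g : (ℕ × ℕ) × List ℕ → ℕ} (hf : Primrec f) (hg : Primrec g) :
      Primrec fun x => Nat.pair (f x) (g x) := Primrec₂.natPair.comp hf hg
  have hq : Primrec fun p : ℕ × ℕ => if p.2.unpair.1 = 0 then [] else
      [(p.1, p.2.unpair.2.unpair.1), (p.1, p.2.unpair.2.unpair.2),
        (Nat.succ p.1, p.2.unpair.2.unpair.2)] := by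
    have hr : Primrec fun p : ℕ × ℕ => p.2.unpair.2 := snd.comp (unpair.comp snd)
    refine primrec_tag_ite 0 snd (.const _) (list_cons.comp
      (fst.pair (fst.comp (unpair.comp hr))) (list_cons.comp
        (fst.pair (snd.comp (unpair.comp hr))) (list_cons.comp
          ((Primrec.succ.comp fst).pair (snd.comp (unpair.comp hr))) (.const _))))
  have ht₁ : Primrec fun x : (ℕ × ℕ) × List ℕ =>
      termCode (decodeTerm x.1.1 x.1.2.unpair.2.unpair.1) :=
    primrec_termCode_decodeTerm.comp ((fst.comp fst).pair (fst.comp (unpair.comp hr)))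
  have ht₂ : Primrec fun x : (ℕ × ℕ) × List ℕ =>
      termCode (decodeTerm x.1.1 x.1.2.unpair.2.unpair.2) :=
    primrec_termCode_decodeTerm.comp ((fst.comp fst).pair (snd.comp (unpair.comp hr)))
  have hlt : Primrec fun x : (ℕ × ℕ) × List ℕ => Nat.pair 2 (Nat.pair (Nat.pair 0 x.1.1)
      (termCode (decodeTerm x.1.1 x.1.2.unpair.2.unpair.1))) :=
    hpair (.const 2) (hpair (hpair (.const 0) (fst.comp fst)) ht₁)
  have himp {f g : (ℕ × ℕ) × List ℕ → ℕ} (hf : Primrec f) (hg : Primrec g) :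
      Primrec fun x => Nat.pair 3 (Nat.pair (f x) (g x)) := hpair (.const 3) (hpair hf hg)
  have hnot {f : (ℕ × ℕ) × List ℕ → ℕ} (hf : Primrec f) :
      Primrec fun x => Nat.pair 3 (Nat.pair (f x) (Nat.pair 0 0)) := himp hf (.const _)
  have hg : Primrec fun x : (ℕ × ℕ) × List ℕ => some (
      if x.1.2.unpair.1 = 0 then Nat.pair 0 0
      else if x.1.2.unpair.1 = 1 then
        Nat.pair 1 (Nat.pair (termCode (decodeTerm x.1.1 x.1.2.unpair.2.unpair.1))
          (termCode (decodeTerm x.1.1 x.1.2.unpair.2.unpair.2)))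
      else if x.1.2.unpair.1 = 2 then
        Nat.pair 2 (Nat.pair (termCode (decodeTerm x.1.1 x.1.2.unpair.2.unpair.1))
          (termCode (decodeTerm x.1.1 x.1.2.unpair.2.unpair.2)))
      else if x.1.2.unpair.1 = 3 then Nat.pair 3 (Nat.pair (x.2.getD 0 0) (x.2.getD 1 0))
      else if x.1.2.unpair.1 = 4 then
        Nat.pair 4 (Nat.pair 3 (Nat.pair (Nat.pair 2 (Nat.pair (Nat.pair 0 x.1.1)
          (termCode (decodeTerm x.1.1 x.1.2.unpair.2.unpair.1)))) (x.2.getD 2 0)))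
      -- The bounded `∃` unfolded: `∃` is `¬∀¬`, `⊓` is `¬(· → ¬·)`, and each negation is an
      -- implication to `⊥`, whose code is `Nat.pair 0 0`.
      else Nat.pair 3 (Nat.pair (Nat.pair 4 (Nat.pair 3 (Nat.pair (Nat.pair 3 (Nat.pair (Nat.pair 3
        (Nat.pair (Nat.pair 2 (Nat.pair (Nat.pair 0 x.1.1)
          (termCode (decodeTerm x.1.1 x.1.2.unpair.2.unpair.1))))
            (Nat.pair 3 (Nat.pair (x.2.getD 2 0) (Nat.pair 0 0))))) (Nat.pair 0 0)))
              (Nat.pair 0 0)))) (Nat.pair 0 0))) := by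
    have hk : Primrec fun x : (ℕ × ℕ) × List ℕ => x.1.2 := snd.comp fst
    exact option_some.comp (primrec_tag_ite 0 hk (.const _)
      (primrec_tag_ite 1 hk (hpair (.const 1) (hpair ht₁ ht₂))
      (primrec_tag_ite 2 hk (hpair (.const 2) (hpair ht₁ ht₂))
      (primrec_tag_ite 3 hk (himp (hv 0) (hv 1))
      (primrec_tag_ite 4 hk (hpair (.const 4) (himp hlt (hv 2)))
        (hnot (hpair (.const 4) (hnot (hnot (himp hlt (hnot (hv 2))))))))))))
  -- Codes record only the number of a variable, and adding a new last variable leaves these numbers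
  -- unchanged.
  have htc {n : ℕ} (t : arith.Term (Empty ⊕ Fin n)) :
      termCode (t.relabel (Sum.map id Fin.castSucc)) = termCode t := by
    induction t with
    | var x =>
      rcases x with a | j
      · exact a.elim
      · rfl
    | func f ts ih => cases f <;> simp [termCode, ih]
  have hlast {n : ℕ} (t : arith.Term (Empty ⊕ Fin n)) :
      code (lastLt t) = Nat.pair 2 (Nat.pair (Nat.pair 0 n) (termCode t)) := by
    simp [lastLt, lt, code, termCode, htc]
  refine nat_omega_rec' _ (m := Prod.snd) snd hq hg.to₂ ?_ ?_
  · rintro ⟨n, k⟩ p hp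
    dsimp only at hp
    split_ifs at hp with h
    · simp at hp
    · have := unpair_lt h
      simp at hp
      rcases hp with rfl | rfl | rfl <;> simp [this]
  · rintro ⟨n, k⟩
    dsimp only
    conv_rhs => rw [decodeFormula]
    split_ifs
    · rfl
    · rfl
    · simp [code, lt]
    · simp [code]
    · simp [code, hlast]
    · simp only [List.map, List.getD_cons_succ, List.getD_cons_zero, ← hlast]
      rfl

open Classical in
/-- The truth value of the `k`-th `Σ⁰₀` formula, the variables being interpreted by the list
`l`. -/
noncomputable def evalFormula (l : List ℕ) (k : ℕ) : Bool :=
  decide ((decodeFormula l.length k).Realize default l.get)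

theorem evalFormula_iff {n : ℕ} {w : Fin n → ℕ} {l : List ℕ} {k : ℕ} (hl : l = List.ofFn w) :
    evalFormula l k = true ↔ (decodeFormula n k).Realize default w := by
  -- The type of `w` depends on `n`; with both generalized, `n` can be replaced by the length of
  -- `l`.
  have key : ∀ (n : ℕ) (w : Fin n → ℕ), n = l.length → (∀ j, l[j]? = some (w j)) →
      (evalFormula l k = true ↔ (decodeFormula n k).Realize default w) := by
    rintro n w rfl hw
    have : w = l.get := by
      funext j
      have := hw j
      simpa using this.symm
    simp [evalFormula, this]
  exact key n w (by simp [hl]) (by simp [hl])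

theorem evalFormula_concat {l : List ℕ} {k m : ℕ} :
    (decodeFormula (l.length + 1) k).Realize default
      (Fin.snoc (α := fun _ => ℕ) l.get m) ↔ evalFormula (l ++ [m]) k = true := by
  refine (evalFormula_iff ?_).symm
  rw [List.ofFn_succ']
  simp

-- A bounded quantifier is a finite conjunction or disjunction: the recursive calls include the body
-- at `l ++ [j]` for every `j` below the value of the bound. The measure is the index alone, so the
-- growth of the list is harmless.
open Primrec in
theorem primrec_evalFormula : Primrec₂ evalFormula := by
  have hr : Primrec fun x : (List ℕ × ℕ) × List Bool => x.1.2.unpair.2 :=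
    snd.comp (unpair.comp (snd.comp fst))
  have hv (j : ℕ) : Primrec fun x : (List ℕ × ℕ) × List Bool => x.2.getD j false :=
    (list_getD false).comp snd (.const j)
  have ht₁ : Primrec fun x : (List ℕ × ℕ) × List Bool =>
      termValue x.1.1 x.1.2.unpair.2.unpair.1 :=
    primrec_termValue.comp (fst.comp fst) (fst.comp (unpair.comp hr))
  have ht₂ : Primrec fun x : (List ℕ × ℕ) × List Bool =>
      termValue x.1.1 x.1.2.unpair.2.unpair.2 :=
    primrec_termValue.comp (fst.comp fst) (snd.comp (unpair.comp hr))
  have hq : Primrec fun p : List ℕ × ℕ => if p.2.unpair.1 = 0 then [] else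
      (p.1, p.2.unpair.2.unpair.1) :: (p.1, p.2.unpair.2.unpair.2) ::
        (List.range (termValue p.1 p.2.unpair.2.unpair.1)).map fun j =>
          (p.1 ++ [j], p.2.unpair.2.unpair.2) := by
    have hr : Primrec fun p : List ℕ × ℕ => p.2.unpair.2 := snd.comp (unpair.comp snd)
    refine primrec_tag_ite 0 snd (.const _) (list_cons.comp
      (fst.pair (fst.comp (unpair.comp hr))) (list_cons.comp
        (fst.pair (snd.comp (unpair.comp hr))) (list_map (list_range.comp
          (primrec_termValue.comp fst (fst.comp (unpair.comp hr)))) ?_)))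
    exact (list_concat.comp (fst.comp fst) snd).pair (snd.comp (unpair.comp (hr.comp fst)))
  -- The first two values belong to the two halves in the unextended context; dropping them leaves
  -- the instances of the quantified body.
  have hall : Primrec fun x : (List ℕ × ℕ) × List Bool => x.2.tail.tail.foldr and true :=
    list_foldr (list_tail.comp (list_tail.comp snd)) (.const _)
      (h := fun _ p => p.1 && p.2) (Primrec.and.comp (fst.comp snd) (snd.comp snd))
  have hany : Primrec fun x : (List ℕ × ℕ) × List Bool => x.2.tail.tail.foldr or false :=
    list_foldr (list_tail.comp (list_tail.comp snd)) (.const _)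
      (h := fun _ p => p.1 || p.2) (Primrec.or.comp (fst.comp snd) (snd.comp snd))
  have hg : Primrec fun x : (List ℕ × ℕ) × List Bool => some (
      if x.1.2.unpair.1 = 0 then false
      else if x.1.2.unpair.1 = 1 then
        decide (termValue x.1.1 x.1.2.unpair.2.unpair.1 = termValue x.1.1 x.1.2.unpair.2.unpair.2)
      else if x.1.2.unpair.1 = 2 then
        decide (termValue x.1.1 x.1.2.unpair.2.unpair.1 < termValue x.1.1 x.1.2.unpair.2.unpair.2)
      else if x.1.2.unpair.1 = 3 then !(x.2.getD 0 false) || x.2.getD 1 false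
      else if x.1.2.unpair.1 = 4 then x.2.tail.tail.foldr and true
      else x.2.tail.tail.foldr or false) := by
    have hk : Primrec fun x : (List ℕ × ℕ) × List Bool => x.1.2 := snd.comp fst
    exact option_some.comp (primrec_tag_ite 0 hk (.const _)
      (primrec_tag_ite 1 hk (Primrec.eq.comp ht₁ ht₂).decide
      (primrec_tag_ite 2 hk (nat_lt.comp ht₁ ht₂).decide
      (primrec_tag_ite 3 hk (Primrec.or.comp (Primrec.not.comp (hv 0)) (hv 1))
      (primrec_tag_ite 4 hk hall hany)))))
  have hand (l : List Bool) : l.foldr and true = true ↔ ∀ b ∈ l, b = true := by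
    induction l <;> simp_all
  have hor (l : List Bool) : l.foldr or false = true ↔ ∃ b ∈ l, b = true := by
    induction l <;> simp_all
  refine nat_omega_rec' (Function.uncurry evalFormula) (m := Prod.snd) snd hq hg.to₂ ?_ ?_
  · rintro ⟨n, k⟩ p hp
    dsimp only at hp
    split_ifs at hp with h
    · simp at hp
    · have := unpair_lt h
      simp at hp
      rcases hp with rfl | rfl | ⟨j, _, rfl⟩ <;> simp [this]
  · rintro ⟨l, k⟩
    dsimp only [Function.uncurry]
    rw [Option.some_inj, Bool.eq_iff_iff]
    have hrw (k : ℕ) :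
        evalFormula l k = true ↔ (decodeFormula l.length k).Realize default l.get := by
      simp [evalFormula]
    rw [hrw, decodeFormula]
    by_cases h₀ : k.unpair.1 = 0
    · simp [h₀, BoundedFormula.Realize]
    simp only [h₀, ↓reduceIte, ↓reduceDIte, List.map_cons, List.map_map, Function.comp_def,
      Function.uncurry_apply_pair, List.tail_cons, List.getD_cons_succ, List.getD_cons_zero]
    split_ifs
    iterate 4
      · simp only [decide_eq_true_iff]
        rfl
    · rw [BoundedFormula.realize_imp, ← hrw, ← hrw]
      generalize evalFormula l _ = a, evalFormula l _ = b
      cases a <;> simp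
    · simp only [hand, BoundedFormula.realize_all, BoundedFormula.realize_imp, realize_lastLt,
        evalFormula_concat, List.forall_mem_map, List.mem_range]
      rfl
    · simp only [hor, BoundedFormula.realize_ex, BoundedFormula.realize_inf, realize_lastLt,
        evalFormula_concat, List.mem_map, exists_exists_and_eq_and, List.mem_range]
      rfl

end Arith

/-! ### Adding speculations to a stream of marked sentences -/

section ComputablePredicates

variable {α β σ : Type*} [Primcodable α] [Primcodable β] [Primcodable σ]

theorem computablePred_comp {p : β → Prop} {f : α → β} (hp : ComputablePred p)
    (hf : Computable f) : ComputablePred fun x => p (f x) := by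
  classical
  exact ComputablePred.computable_iff.2 ⟨fun x => decide (p (f x)), hp.decide.comp hf, by simp⟩

theorem computablePred_and {p q : α → Prop} (hp : ComputablePred p) (hq : ComputablePred q) :
    ComputablePred fun x => p x ∧ q x := by
  classical
  exact ComputablePred.computable_iff.2 ⟨fun x => decide (p x) && decide (q x),
    Primrec.and.to_comp.comp hp.decide hq.decide, by simp⟩

theorem computablePred_or {p q : α → Prop} (hp : ComputablePred p) (hq : ComputablePred q) :
    ComputablePred fun x => p x ∨ q x := by
  classical
  exact ComputablePred.computable_iff.2 ⟨fun x => decide (p x) || decide (q x),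
    Primrec.or.to_comp.comp hp.decide hq.decide, by simp⟩

theorem computablePred_eq {f g : α → σ} (hf : Computable f) (hg : Computable g) :
    ComputablePred fun x => f x = g x := by
  classical
  exact ComputablePred.computable_iff.2 ⟨fun x => decide (f x = g x),
    Primrec.eq.decide.to_comp.comp hf hg, by simp⟩

theorem computablePred_lt {f g : α → ℕ} (hf : Computable f) (hg : Computable g) :
    ComputablePred fun x => f x < g x :=
  ComputablePred.computable_iff.2 ⟨fun x => decide (f x < g x),
    Primrec.nat_lt.decide.to_comp.comp hf hg, by simp⟩

theorem computablePred_forall_lt {p : α → ℕ → Prop} {f : α → ℕ}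
    (hp : ComputablePred fun x : α × ℕ => p x.1 x.2) (hf : Computable f) :
    ComputablePred fun x => ∀ j < f x, p x j := by
  classical
  refine ComputablePred.computable_iff.2 ⟨_, (Computable.nat_rec (σ := Bool) hf (.const true)
    (h := fun x y => y.2 && decide (p x y.1)) (Primrec.and.to_comp.comp
      (Computable.snd.comp Computable.snd) (hp.decide.comp (Computable.fst.pair
        (Computable.fst.comp Computable.snd))))), ?_⟩
  funext x
  induction f x with
  | zero => simp
  | succ n ih =>
    rw [Bool.and_eq_true, ← ih]
    simp only [Nat.forall_lt_succ_right, decide_eq_true_eq]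

theorem computablePred_exists_lt {p : α → ℕ → Prop} {f : α → ℕ}
    (hp : ComputablePred fun x : α × ℕ => p x.1 x.2) (hf : Computable f) :
    ComputablePred fun x => ∃ j < f x, p x j :=
  (computablePred_forall_lt (p := fun x j => ¬ p x j) hp.not hf).not.of_eq fun x => by simp

theorem computable_ite {c : α → Prop} [DecidablePred c] {f g : α → σ} (hc : ComputablePred c)
    (hf : Computable f) (hg : Computable g) : Computable fun x => if c x then f x else g x :=
  (Computable.cond hc.decide hf hg).of_eq fun x => by by_cases h : c x <;> simp [h]

theorem partrec_ite {c : α → Prop} [DecidablePred c] {f g : α →. σ} (hc : ComputablePred c)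
    (hf : Partrec f) (hg : Partrec g) : Partrec fun x => if c x then f x else g x :=
  (Partrec.cond hc.decide hf hg).of_eq fun x => by by_cases h : c x <;> simp [h]

end ComputablePredicates

/-- The sentences `stmt k` (given by their codes) are conjectured as long as no `m` with
`holds k m = false` has been found; `valid` recognizes the codes of marked sentences, and the
conjecture `top` is never refuted. -/
structure Speculation where
  stmt : ℕ → ℕ
  holds : ℕ → ℕ → Bool
  valid : ℕ → Bool
  top : ℕ
  holds_congr : ∀ {j k : ℕ}, stmt j = stmt k → ∀ m, holds j m = holds k m
  holds_top : ∀ m, holds top m = true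

/-- The stabilization of a stream of codes of marked sentences. -/
def stabilizes (g : ℕ →. ℕ) (β : ℕ) : Prop :=
  ∃ m, Nat.pair β 1 ∈ g m ∧ ∀ n, m < n → Nat.pair β 0 ∉ g n

/-- `Nat.pair` runs through the plane along growing squares, so `max` of the coordinates can serve
as the stage. -/
theorem pair_lt_pair_of_max_lt {a b c d : ℕ} (h : max a b < max c d) :
    Nat.pair a b < Nat.pair c d := by
  have h₁ := Nat.pair_lt_max_add_one_sq a b
  have h₂ := Nat.max_sq_add_min_le_pair c d
  have h₃ : (max a b + 1) ^ 2 ≤ max c d ^ 2 := Nat.pow_le_pow_left h 2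
  omega

/-- Within stage `n`, retraction and replay at `(p, n)`, `p < n`, precede the emissions at `(n, b)`,
`b ≤ n`. -/
theorem pair_lt_pair_swap {p n b : ℕ} (hp : p < n) (hb : b ≤ n) : Nat.pair p n < Nat.pair n b := by
  rw [Nat.pair, Nat.pair, if_pos hp, if_neg (not_lt.2 hb)]
  omega

namespace Speculation

variable (S : Speculation)

/-- No smaller index gives the same sentence. -/
def IsFirst (k : ℕ) : Prop :=
  ∀ j < k, S.stmt j ≠ S.stmt k

/-- The stage `b` finds the first counterexample to one of the conjectures. -/
def Refutes (b : ℕ) : Prop :=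
  S.IsFirst b.unpair.1 ∧ S.holds b.unpair.1 b.unpair.2 = false ∧
    ∀ m < b.unpair.2, S.holds b.unpair.1 m = true

/-- The sentence `β` is conjectured at stage `b`. -/
def Live (β b : ℕ) : Prop :=
  ∃ k < b, S.stmt k = β ∧ S.IsFirst k ∧
    ∀ c < b + 1, c.unpair.1 = k → S.holds k c.unpair.2 = true

/-- The input is needed at the position `(p, b)`. -/
def Asks (p b : ℕ) : Prop :=
  p ≠ 0 ∧ (p < b ∧ S.Refutes b ∨ b = 0)

open Classical in
/-- The output at the position `(p, b)`, where `u` is the input number `p - 1`. -/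
noncomputable def out (p b u : ℕ) : ℕ :=
  if p < b then
    if S.Refutes b then
      if p = 0 then Nat.pair (S.stmt b.unpair.1) 0
      else if S.valid u = true ∧ u.unpair.1 = S.stmt b.unpair.1 then u
      else Nat.pair (S.stmt S.top) 1
    else Nat.pair (S.stmt S.top) 1
  else if b = 0 then
    if p = 0 then Nat.pair (S.stmt S.top) 1
    else if S.valid u = true then
      if S.Live u.unpair.1 p then Nat.pair u.unpair.1 1 else u
    else Nat.pair (S.stmt S.top) 1
  else if S.Live (S.stmt (b - 1)) p then Nat.pair (S.stmt (b - 1)) 1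
  else Nat.pair (S.stmt S.top) 1

open Classical in
/-- The stream `g` enriched by the conjectures. The positions are ordered in stages
`max p b = 0, 1, …`. A stage begins with the retraction, if a conjecture is refuted, followed by a
replay of the earlier inputs on the refuted sentence; then it emits the next input and all the
current conjectures. -/
noncomputable def stream (g : ℕ →. ℕ) (x : ℕ) : Part ℕ :=
  (if S.Asks x.unpair.1 x.unpair.2 then g (x.unpair.1 - 1) else Part.some 0).map
    (S.out x.unpair.1 x.unpair.2)

variable {S}

section Membership

variable {g : ℕ →. ℕ} {p b u β : ℕ}

theorem mem_stream_replay (hb : S.Refutes b) (hp : p ≠ 0) (hpb : p < b) (hu : u ∈ g (p - 1))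
    (hv : S.valid u = true) (hβ : u.unpair.1 = S.stmt b.unpair.1) :
    u ∈ S.stream g (Nat.pair p b) := by
  rw [stream, Nat.unpair_pair, if_pos ⟨hp, Or.inl ⟨hpb, hb⟩⟩, Part.mem_map_iff]
  exact ⟨u, hu, by simp [out, hpb, hb, hp, hv, hβ]⟩

theorem mem_stream_retract (hb : S.Refutes b) (h₀ : 0 < b) :
    Nat.pair (S.stmt b.unpair.1) 0 ∈ S.stream g (Nat.pair 0 b) := by
  rw [stream, Nat.unpair_pair, if_neg (by simp [Asks]), Part.mem_map_iff]
  exact ⟨0, Part.mem_some _, by simp [out, h₀, hb]⟩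

open Classical in
theorem mem_stream_emit (hp : p ≠ 0) (hu : u ∈ g (p - 1)) (hv : S.valid u = true) :
    (if S.Live u.unpair.1 p then Nat.pair u.unpair.1 1 else u) ∈ S.stream g (Nat.pair p 0) := by
  rw [stream, Nat.unpair_pair, if_pos ⟨hp, Or.inr rfl⟩, Part.mem_map_iff]
  exact ⟨u, hu, by simp [out, hp, hv]⟩

theorem mem_stream_live (hb : b ≠ 0) (hbp : b ≤ p) (h : S.Live (S.stmt (b - 1)) p) :
    Nat.pair (S.stmt (b - 1)) 1 ∈ S.stream g (Nat.pair p b) := by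
  rw [stream, Nat.unpair_pair, if_neg (by simp [Asks, hb, hbp.not_gt]), Part.mem_map_iff]
  exact ⟨0, Part.mem_some _, by simp [out, hb, hbp.not_gt, h]⟩

-- The five sources of an output are, in this order: filler, retraction, replay, current input, live
-- conjecture.
open Classical in
theorem mem_stream_cases {x y : ℕ} (hy : y ∈ S.stream g x) : ∃ p b, x = Nat.pair p b ∧
    (y = Nat.pair (S.stmt S.top) 1 ∨
    (p = 0 ∧ 0 < b ∧ S.Refutes b ∧ y = Nat.pair (S.stmt b.unpair.1) 0) ∨
    (p ≠ 0 ∧ p < b ∧ S.Refutes b ∧ y ∈ g (p - 1) ∧ S.valid y = true ∧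
      y.unpair.1 = S.stmt b.unpair.1) ∨
    (b = 0 ∧ p ≠ 0 ∧ ∃ u ∈ g (p - 1), S.valid u = true ∧
      y = if S.Live u.unpair.1 p then Nat.pair u.unpair.1 1 else u) ∨
    (b ≠ 0 ∧ b ≤ p ∧ S.Live (S.stmt (b - 1)) p ∧ y = Nat.pair (S.stmt (b - 1)) 1)) := by
  refine ⟨x.unpair.1, x.unpair.2, (Nat.pair_unpair x).symm, ?_⟩
  rw [stream, Part.mem_map_iff] at hy
  obtain ⟨u, hu, rfl⟩ := hy
  generalize x.unpair.1 = p, x.unpair.2 = b at *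
  rw [out]
  split_ifs with h₁ h₂ h₃ h₄ h₅ h₆ h₇ h₈ h₉
  · exact Or.inr (Or.inl ⟨h₃, by omega, h₂, rfl⟩)
  · rw [if_pos ⟨h₃, Or.inl ⟨h₁, h₂⟩⟩] at hu
    exact Or.inr (Or.inr (Or.inl ⟨h₃, h₁, h₂, hu, h₄⟩))
  · exact Or.inl rfl
  · exact Or.inl rfl
  · exact Or.inl rfl
  · rw [if_pos ⟨h₆, Or.inr h₅⟩] at hu
    exact Or.inr (Or.inr (Or.inr (Or.inl ⟨h₅, h₆, u, hu, h₇, by rw [if_pos h₈]⟩)))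
  · rw [if_pos ⟨h₆, Or.inr h₅⟩] at hu
    exact Or.inr (Or.inr (Or.inr (Or.inl ⟨h₅, h₆, u, hu, h₇, by rw [if_neg h₈]⟩)))
  · exact Or.inl rfl
  · exact Or.inr (Or.inr (Or.inr (Or.inr ⟨h₅, not_lt.1 h₁, by assumption, rfl⟩)))
  · exact Or.inl rfl

end Membership

/-! ### Stabilization of the enriched stream -/

theorem IsFirst.eq {j k : ℕ} (hj : S.IsFirst j) (hk : S.IsFirst k) (h : S.stmt j = S.stmt k) :
    j = k := by
  rcases lt_trichotomy j k with hlt | rfl | hlt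
  · exact absurd h (hk _ hlt)
  · rfl
  · exact absurd h.symm (hj _ hlt)

theorem exists_isFirst (k : ℕ) : ∃ j, S.IsFirst j ∧ S.stmt j = S.stmt k := by
  classical
  have h : ∃ j, S.stmt j = S.stmt k := ⟨k, rfl⟩
  refine ⟨Nat.find h, fun j hj hjk => Nat.find_min h hj (hjk.trans (Nat.find_spec h)),
    Nat.find_spec h⟩

theorem stabilizes_of_holds {g : ℕ →. ℕ} {k : ℕ} (hk : ∀ m, S.holds k m = true) :
    stabilizes (S.stream g) (S.stmt k) := by
  obtain ⟨j, hj, hjk⟩ := exists_isFirst (S := S) k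
  have hjm (m : ℕ) : S.holds j m = true := (S.holds_congr hjk m).trans (hk m)
  have hlive {n : ℕ} (hn : j < n) : S.Live (S.stmt k) n := ⟨j, hn, hjk, hj, fun _ _ _ => hjm _⟩
  have hrefutes {b : ℕ} (hb : S.Refutes b) : S.stmt b.unpair.1 ≠ S.stmt k := fun h => by
    have := hb.2.1
    rw [S.holds_congr h, hk] at this
    exact absurd this (by simp)
  -- The last position of stage `j + 1` announces conjecture `j`. All later inputs come at stages
  -- where it is live, so a `-` among them is overwritten.
  refine ⟨Nat.pair (j + 1) (j + 1), ?_, fun x hx hmem => ?_⟩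
  · have := mem_stream_live (S := S) (g := g) (p := j + 1) (b := j + 1) (by omega) le_rfl
      (by simpa [hjk] using hlive (Nat.lt_succ_self j))
    simpa [hjk] using this
  · obtain ⟨p, b, rfl, h | ⟨_, _, hb, h⟩ | ⟨_, _, hb, _, _, h⟩ | ⟨rfl, _, u, _, _, h⟩ |
      ⟨_, _, _, h⟩⟩ := mem_stream_cases hmem
    · simp [Nat.pair_eq_pair] at h
    · exact hrefutes hb (Nat.pair_eq_pair.1 h).1.symm
    · rw [Nat.unpair_pair] at h
      exact hrefutes hb h.symm
    · split_ifs at h with hu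
      · simp [Nat.pair_eq_pair] at h
      · subst h
        refine hu ?_
        rw [Nat.unpair_pair]
        refine hlive ?_
        by_contra hp
        exact hx.not_gt (pair_lt_pair_of_max_lt (by simp; omega))
    · simp [Nat.pair_eq_pair] at h

/-- A sentence that is not a true conjecture has one stage `r` from which it is never live, and a
retraction of it can occur only there. Passing to first indices makes this stage unique although
many indices give the same sentence. -/
theorem exists_refutation_stage {β : ℕ}
    (hβ : ¬ ∃ k, S.stmt k = β ∧ ∀ m, S.holds k m = true) :
    ∃ r, (∀ n, r ≤ n → ¬ S.Live β n) ∧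
      ∀ b, 0 < b → (S.Refutes b ∧ S.stmt b.unpair.1 = β ↔ b = r) := by
  classical
  by_cases h : ∃ k, S.stmt k = β
  · obtain ⟨k', rfl⟩ := h
    obtain ⟨k, hk, hkk'⟩ := exists_isFirst (S := S) k'
    have hm : ∃ m, S.holds k m = false := by
      by_contra! h
      exact hβ ⟨k, hkk', fun m => by simpa using h m⟩
    -- The stage coding the first index and its least counterexample.
    refine ⟨Nat.pair k (Nat.find hm), fun n hn ⟨j, _, hj, hj', hlive⟩ => ?_, fun b _ => ?_⟩
    · obtain rfl := hj'.eq hk (hj.trans hkk'.symm)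
      have := hlive _ (Nat.lt_succ_of_le hn) (by simp)
      rw [Nat.unpair_pair, Nat.find_spec hm] at this
      exact absurd this (by simp)
    · constructor
      · rintro ⟨⟨hf, hfalse, hmin⟩, hb⟩
        have h₁ := hf.eq hk (hb.trans hkk'.symm)
        rw [h₁] at hfalse hmin
        rw [← Nat.pair_unpair b, h₁]
        congr 1
        refine ((Nat.find_eq_iff hm).2 ⟨hfalse, fun m hm' => ?_⟩).symm
        simp [hmin m hm']
      · rintro rfl
        rw [Refutes, Nat.unpair_pair]
        exact ⟨⟨hk, Nat.find_spec hm, fun m hm' => by simpa using Nat.find_min hm hm'⟩, hkk'⟩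
  -- For a sentence never conjectured `r = 0` serves: only positive stages can retract.
  · exact ⟨0, fun n _ ⟨k, _, hk, _⟩ => h ⟨k, hk⟩,
      fun b hb => ⟨fun hb' => absurd ⟨_, hb'.2⟩ h, fun hb' => absurd hb' hb.ne'⟩⟩

theorem stabilizes_stream_of_stabilizes {g : ℕ →. ℕ} (hg : ∀ n, ∀ u ∈ g n, S.valid u = true)
    {β : ℕ} (h : stabilizes g β) : stabilizes (S.stream g) β := by
  by_cases hβ : ∃ k, S.stmt k = β ∧ ∀ m, S.holds k m = true
  · obtain ⟨k, rfl, hk⟩ := hβ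
    exact stabilizes_of_holds hk
  obtain ⟨r, hlive, hr⟩ := exists_refutation_stage hβ
  obtain ⟨m, hm, hlast⟩ := h
  -- Input `m` arrives at stage `m + 1`. If the refutation is not later, the retraction and replay
  -- precede the emission of this input, which passes unchanged; otherwise the witness is its replay
  -- at stage `r`.
  by_cases hrm : r ≤ m + 1
  · refine ⟨Nat.pair (m + 1) 0, ?_, fun x hx hmem => ?_⟩
    · have := mem_stream_emit (S := S) m.succ_ne_zero hm (hg _ _ hm)
      rwa [Nat.unpair_pair, if_neg (hlive _ hrm)] at this
    · have hbefore {p : ℕ} (hp : p < r) : ¬ Nat.pair (m + 1) 0 < Nat.pair p r := by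
        refine not_lt.2 (le_of_lt ?_)
        rcases hrm.eq_or_lt with rfl | hlt
        · exact pair_lt_pair_swap hp (Nat.zero_le _)
        · exact pair_lt_pair_of_max_lt (by simp; omega)
      obtain ⟨p, b, rfl, h | ⟨rfl, hb₀, hb, h⟩ | ⟨_, hpb, hb, _, _, h⟩ | ⟨rfl, hp, u, hu, _, h⟩ |
        ⟨_, _, _, h⟩⟩ := mem_stream_cases hmem
      · simp [Nat.pair_eq_pair] at h
      · obtain rfl := (hr b hb₀).1 ⟨hb, (Nat.pair_eq_pair.1 h).1.symm⟩
        exact hbefore hb₀ hx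
      · rw [Nat.unpair_pair] at h
        obtain rfl := (hr b (by omega)).1 ⟨hb, h.symm⟩
        exact hbefore hpb hx
      · split_ifs at h with hu'
        · simp [Nat.pair_eq_pair] at h
        · subst h
          refine hlast (p - 1) ?_ hu
          by_contra hp'
          exact hx.not_ge (by
            rcases (show p ≤ m + 1 by omega).eq_or_lt with rfl | hlt
            · exact le_rfl
            · exact (Nat.pair_lt_pair_left 0 hlt).le)
      · simp [Nat.pair_eq_pair] at h
  · obtain ⟨hb, hbβ⟩ := (hr r (by omega)).2 rfl
    refine ⟨Nat.pair (m + 1) r, ?_, fun x hx hmem => ?_⟩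
    · exact mem_stream_replay hb m.succ_ne_zero (by omega) hm (hg _ _ hm) (by simp [hbβ])
    · obtain ⟨p, b, rfl, h | ⟨rfl, hb₀, hb, h⟩ | ⟨_, hpb, hb, hy, _, h⟩ | ⟨rfl, hp, u, hu, _, h⟩ |
        ⟨_, _, _, h⟩⟩ := mem_stream_cases hmem
      · simp [Nat.pair_eq_pair] at h
      · obtain rfl := (hr b hb₀).1 ⟨hb, (Nat.pair_eq_pair.1 h).1.symm⟩
        exact hx.not_gt (Nat.pair_lt_pair_left _ m.succ_pos)
      · rw [Nat.unpair_pair] at h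
        obtain rfl := (hr b (by omega)).1 ⟨hb, h.symm⟩
        refine hlast (p - 1) ?_ hy
        by_contra hp'
        exact hx.not_ge (by
          rcases (show p ≤ m + 1 by omega).eq_or_lt with rfl | hlt
          · exact le_rfl
          · exact (Nat.pair_lt_pair_left b hlt).le)
      · split_ifs at h with hu'
        · simp [Nat.pair_eq_pair] at h
        · subst h
          refine hlast (p - 1) ?_ hu
          by_contra hp'
          exact hx.not_gt (pair_lt_pair_of_max_lt (by simp; omega))
      · simp [Nat.pair_eq_pair] at h

/-- A `+` issued before stage `r` is undone by the retraction at `(0, r)`. From then on the outputs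
on `β` are inputs of `g` in their order, replayed or current, so a later `-` of `g` would reappear
in the stream. -/
theorem stabilizes_or_holds_of_stabilizes_stream {g : ℕ →. ℕ}
    (hg : ∀ n, ∀ u ∈ g n, S.valid u = true) {β : ℕ} (h : stabilizes (S.stream g) β) :
    stabilizes g β ∨ ∃ k, S.stmt k = β ∧ ∀ m, S.holds k m = true := by
  refine or_iff_not_imp_right.2 fun hβ => ?_
  obtain ⟨r, hlive, hr⟩ := exists_refutation_stage hβ
  obtain ⟨x, hx, hlast⟩ := h
  have hretract {p b : ℕ} (hpr : max p b < r) (hpb : x = Nat.pair p b) : False := by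
    obtain ⟨hb, hbβ⟩ := (hr r (by omega)).2 rfl
    refine hlast (Nat.pair 0 r) ?_ (hbβ ▸ mem_stream_retract hb (by omega))
    rw [hpb]
    exact pair_lt_pair_of_max_lt (by simpa using hpr)
  have hemit {n : ℕ} (hn : r ≤ n + 1) (h : Nat.pair β 0 ∈ g n) :
      Nat.pair β 0 ∈ S.stream g (Nat.pair (n + 1) 0) := by
    have := mem_stream_emit (S := S) n.succ_ne_zero h (hg _ _ h)
    rwa [Nat.unpair_pair, if_neg (hlive _ hn)] at this
  obtain ⟨p, b, rfl, h | ⟨_, _, hb, h⟩ | ⟨hp, hpb, hb, hy, _, h⟩ | ⟨rfl, hp, u, hu, _, h⟩ |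
      ⟨_, hbp, hbl, h⟩⟩ := mem_stream_cases hx
  · exact absurd ⟨S.top, (Nat.pair_eq_pair.1 h).1.symm, S.holds_top⟩ hβ
  · simp [Nat.pair_eq_pair] at h
  · rw [Nat.unpair_pair] at h
    obtain rfl := (hr b (by omega)).1 ⟨hb, h.symm⟩
    refine ⟨p - 1, hy, fun n hn hmem => ?_⟩
    by_cases hnb : n + 1 < b
    · exact hlast _ (Nat.pair_lt_pair_left _ (by omega))
        (mem_stream_replay hb n.succ_ne_zero hnb hmem (hg _ _ hmem) (by simp [h]))
    · refine hlast _ ?_ (hemit (not_lt.1 hnb) hmem)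
      rcases (not_lt.1 hnb).eq_or_lt with rfl | hlt
      · exact pair_lt_pair_swap hpb (Nat.zero_le _)
      · exact pair_lt_pair_of_max_lt (by simp; omega)
  · by_cases hpr : p < r
    · exact (hretract (by simpa using hpr) rfl).elim
    · split_ifs at h with hu'
      · rw [← (Nat.pair_eq_pair.1 h).1] at hu'
        exact absurd hu' (hlive _ (not_lt.1 hpr))
      · subst h
        exact ⟨p - 1, hu, fun n hn hmem => hlast _ (Nat.pair_lt_pair_left _ (by omega))
          (hemit (by omega) hmem)⟩
  · by_cases hpr : p < r
    · exact (hretract (by simp; omega) rfl).elim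
    · rw [← (Nat.pair_eq_pair.1 h).1] at hbl
      exact absurd hbl (hlive _ (not_lt.1 hpr))

theorem stream_dom {g : ℕ →. ℕ} (hg : ∀ n, (g n).Dom) (x : ℕ) : (S.stream g x).Dom := by
  rw [stream]
  split_ifs
  · exact hg _
  · trivial

theorem valid_of_mem_stream {g : ℕ →. ℕ}
    (hS : ∀ k, S.valid (Nat.pair (S.stmt k) 0) = true ∧ S.valid (Nat.pair (S.stmt k) 1) = true)
    (hv : ∀ u, S.valid u = true → S.valid (Nat.pair u.unpair.1 1) = true)
    {x y : ℕ} (hy : y ∈ S.stream g x) : S.valid y = true := by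
  obtain ⟨p, b, rfl, rfl | ⟨_, _, _, rfl⟩ | ⟨_, _, _, _, h, _⟩ | ⟨rfl, _, u, _, hu, rfl⟩ |
      ⟨_, _, _, rfl⟩⟩ := mem_stream_cases hy
  · exact (hS _).2
  · exact (hS _).1
  · exact h
  · split_ifs
    · exact hv u hu
    · exact hu
  · exact (hS _).2

/-! ### Computability of the enriched stream -/

section Computability

open Computable in
theorem computable_unpair_fst {α : Type*} [Primcodable α] {f : α → ℕ} (hf : Computable f) :
    Computable fun x => (f x).unpair.1 :=
  fst.comp (unpair.comp hf)

open Computable in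
theorem computable_unpair_snd {α : Type*} [Primcodable α] {f : α → ℕ} (hf : Computable f) :
    Computable fun x => (f x).unpair.2 :=
  snd.comp (unpair.comp hf)

theorem computablePred_isFirst (hstmt : Computable S.stmt) : ComputablePred S.IsFirst :=
  computablePred_forall_lt (p := fun k j => S.stmt j ≠ S.stmt k)
    (computablePred_eq (hstmt.comp .snd) (hstmt.comp .fst)).not .id

theorem computablePred_refutes (hstmt : Computable S.stmt) (hholds : Computable₂ S.holds) :
    ComputablePred S.Refutes := by
  have h₁ : Computable fun b : ℕ => b.unpair.1 := computable_unpair_fst .id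
  have h₂ : Computable fun b : ℕ => b.unpair.2 := computable_unpair_snd .id
  exact computablePred_and (computablePred_comp (computablePred_isFirst hstmt) h₁)
    (computablePred_and (computablePred_eq (hholds.comp h₁ h₂) (.const false))
      (computablePred_forall_lt (p := fun b m => S.holds b.unpair.1 m = true)
        (computablePred_eq (hholds.comp (h₁.comp .fst) .snd) (.const true)) h₂))

open Computable in
theorem computablePred_live (hstmt : Computable S.stmt) (hholds : Computable₂ S.holds) :
    ComputablePred fun x : ℕ × ℕ => S.Live x.1 x.2 := by
  refine computablePred_exists_lt (p := fun (x : ℕ × ℕ) k => S.stmt k = x.1 ∧ S.IsFirst k ∧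
    ∀ c < x.2 + 1, c.unpair.1 = k → S.holds k c.unpair.2 = true) ?_ snd
  refine computablePred_and (computablePred_eq (hstmt.comp snd) (fst.comp fst))
    (computablePred_and (computablePred_comp (computablePred_isFirst hstmt) snd) ?_)
  refine computablePred_forall_lt (p := fun (y : (ℕ × ℕ) × ℕ) c => c.unpair.1 = y.2 →
    S.holds y.2 c.unpair.2 = true) ?_ (succ.comp (snd.comp fst))
  refine (computablePred_or (computablePred_eq (computable_unpair_fst snd) (snd.comp fst)).not
    (computablePred_eq (hholds.comp (snd.comp fst) (computable_unpair_snd snd))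
      (.const true))).of_eq fun x => ?_
  exact imp_iff_not_or.symm

open Computable Classical in
theorem computable_out (hstmt : Computable S.stmt) (hholds : Computable₂ S.holds)
    (hvalid : Computable S.valid) : Computable fun x : ℕ × ℕ × ℕ => S.out x.1 x.2.1 x.2.2 := by
  have hp : Computable fun x : ℕ × ℕ × ℕ => x.1 := fst
  have hb : Computable fun x : ℕ × ℕ × ℕ => x.2.1 := fst.comp snd
  have hu : Computable fun x : ℕ × ℕ × ℕ => x.2.2 := snd.comp snd
  have hmark {f : ℕ × ℕ × ℕ → ℕ} (hf : Computable f) (s : ℕ) :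
      Computable fun x => Nat.pair (f x) s := Primrec₂.natPair.to_comp.comp hf (.const s)
  have hb₁ := hstmt.comp (computable_unpair_fst hb)
  have hb₂ := hstmt.comp (pred.comp hb)
  have hu₁ := computable_unpair_fst hu
  have hv := computablePred_eq (hvalid.comp hu) (.const true)
  have hlive {f : ℕ × ℕ × ℕ → ℕ} (hf : Computable f) :
      ComputablePred fun x => S.Live (f x) x.1 :=
    computablePred_comp (p := fun y : ℕ × ℕ => S.Live y.1 y.2) (f := fun x => (f x, x.1))
      (computablePred_live hstmt hholds) (hf.pair hp)
  have htop : Computable fun _ : ℕ × ℕ × ℕ => Nat.pair (S.stmt S.top) 1 := .const _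
  exact computable_ite (computablePred_lt hp hb)
    (computable_ite (computablePred_comp (computablePred_refutes hstmt hholds) hb)
      (computable_ite (computablePred_eq hp (.const 0)) (hmark hb₁ 0)
        (computable_ite (computablePred_and hv (computablePred_eq hu₁ hb₁)) hu htop)) htop)
    (computable_ite (computablePred_eq hb (.const 0))
      (computable_ite (computablePred_eq hp (.const 0)) htop
        (computable_ite hv (computable_ite (hlive hu₁) (hmark hu₁ 1) hu) htop))
      (computable_ite (hlive hb₂) (hmark hb₂ 1) htop))

open Computable in
theorem partrec_stream (hstmt : Computable S.stmt) (hholds : Computable₂ S.holds)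
    (hvalid : Computable S.valid) :
    Partrec fun x : Nat.Partrec.Code × ℕ => S.stream x.1.eval x.2 := by
  classical
  have hp : Computable fun x : Nat.Partrec.Code × ℕ => x.2.unpair.1 := computable_unpair_fst snd
  have hb : Computable fun x : Nat.Partrec.Code × ℕ => x.2.unpair.2 := computable_unpair_snd snd
  have hask : ComputablePred fun x : Nat.Partrec.Code × ℕ =>
      S.Asks x.2.unpair.1 x.2.unpair.2 :=
    computablePred_and (computablePred_eq hp (.const 0)).not (computablePred_or
      (computablePred_and (computablePred_lt hp hb)
        (computablePred_comp (computablePred_refutes hstmt hholds) hb))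
      (computablePred_eq hb (.const 0)))
  have hp' : Computable fun x : Nat.Partrec.Code × ℕ => x.2.unpair.1 - 1 :=
    Primrec.nat_sub.to_comp.comp hp (.const 1)
  have heval : Partrec fun x : Nat.Partrec.Code × ℕ => x.1.eval (x.2.unpair.1 - 1) :=
    Nat.Partrec.Code.eval_part.comp fst hp'
  have harg : Computable fun y : (Nat.Partrec.Code × ℕ) × ℕ =>
      (y.1.2.unpair.1, y.1.2.unpair.2, y.2) :=
    (computable_unpair_fst (snd.comp fst)).pair ((computable_unpair_snd (snd.comp fst)).pair snd)
  have hout := (computable_out hstmt hholds hvalid).comp harg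
  have hzero : Partrec fun _ : Nat.Partrec.Code × ℕ => Part.some 0 := (Computable.const 0).partrec
  exact (partrec_ite hask heval hzero).map hout.to₂

/-- The stream is partial recursive uniformly in the machine, by the universal function; currying
(s-m-n) then turns the machine into a parameter. -/
theorem exists_computable_stream (hstmt : Computable S.stmt) (hholds : Computable₂ S.holds)
    (hvalid : Computable S.valid) :
    ∃ Spec : Nat.Partrec.Code → Nat.Partrec.Code, Computable Spec ∧
      ∀ T x, (Spec T).eval x = S.stream T.eval x := by
  have hof : Computable fun n : ℕ => Denumerable.ofNat Nat.Partrec.Code n.unpair.1 :=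
    (Computable.ofNat _).comp (computable_unpair_fst .id)
  have harg : Computable fun n : ℕ =>
      (Denumerable.ofNat Nat.Partrec.Code n.unpair.1, n.unpair.2) :=
    hof.pair (computable_unpair_snd .id)
  have h := (partrec_stream hstmt hholds hvalid).comp harg
  obtain ⟨c, hc⟩ := Nat.Partrec.Code.exists_code.1 (Partrec.nat_iff.1 h)
  refine ⟨fun T => c.curry (Encodable.encode T),
    Nat.Partrec.Code.primrec₂_curry.to_comp.comp (.const c) Computable.encode, fun T x => ?_⟩
  simp only [Nat.Partrec.Code.eval_curry, hc, Nat.unpair_pair, Denumerable.ofNat_encode]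

end Computability

end Speculation

/-! ### Consistency of the enriched theory -/

section Consistency

variable {L : FirstOrder.Language.{u, v}}

/-- A translation need not respect quantifiers, so entailments between universal sentences are
derived in arithmetic and only then transported. -/
theorem proves_all_of_proves_all {F : Set L.Sentence}
    {φ ψ : L.BoundedFormula Empty 1}
    (h : ∀ (Γ : Set (L.Formula ℕ)) (w : Fin 1 → L.Term ℕ),
      Derivable Γ (inst φ w) → Derivable Γ (inst ψ w))
    (hφ : Proves F φ.all) : Proves F ψ.all := by
  have hφ' := hφ
  rw [Proves, ofSentence_eq_inst] at hφ ⊢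
  refine .inst_allI (h _ _ ?_)
  rw [Proves, ← shift_image_ofSentence] at hφ'
  rw [ofSentence_eq_inst] at hφ'
  have := hφ'.inst_allE (Term.var 0)
  convert this using 3

/-- The `Σ⁰₀` formulas `φ` for which `∀ m, φ(m)` is true. -/
def TrueSigmaZero (φ : arith.BoundedFormula Empty 1) : Prop :=
  Arith.IsSigmaZero φ ∧ ∀ m : ℕ, φ.Realize default fun _ => m

theorem TrueSigmaZero.inf {φ ψ : arith.BoundedFormula Empty 1} (hφ : TrueSigmaZero φ)
    (hψ : TrueSigmaZero ψ) : TrueSigmaZero (φ ⊓ ψ) :=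
  ⟨.imp (.imp hφ.1 (.imp hψ.1 .falsum)) .falsum,
    fun m => BoundedFormula.realize_inf.2 ⟨hφ.2 m, hψ.2 m⟩⟩

theorem trueSigmaZero_top : TrueSigmaZero (BoundedFormula.falsum.imp .falsum) :=
  ⟨.imp .falsum .falsum, fun _ h => h⟩

theorem IsTranslation.proves_singleton {i : arith.Sentence → L.Sentence} (hi : IsTranslation i)
    {α β : arith.Sentence} (h : Proves {α} β) :
    Derivable {ofSentence (i α)} (ofSentence (i β)) := by
  have := hi.map_proves _ _ h
  rwa [Set.image_singleton, Proves, Set.image_singleton] at this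

/-- Compactness, followed by merging: the conjectures used are replaced one by one by a single `∀ m,
(φ ∧ ψ)(m)`, which implies each of them already in arithmetic. -/
theorem exists_trueSigmaZero_derivable {i : arith.Sentence → L.Sentence} (hi : IsTranslation i)
    {F G : Set L.Sentence} (hG : ∀ β ∈ G, β ∈ F ∨ ∃ φ, TrueSigmaZero φ ∧ i φ.all = β)
    {χ : L.Formula ℕ} (h : Derivable (ofSentence '' G) χ) :
    ∃ φ, TrueSigmaZero φ ∧
      Derivable (insert (ofSentence (i φ.all)) (ofSentence '' F)) χ := by
  obtain ⟨Δ, hΔ, hf, h'⟩ := h.exists_finite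
  clear h
  induction Δ, hf using Set.Finite.induction_on generalizing χ with
  | empty => exact ⟨_, trueSigmaZero_top, h'.mono (Set.empty_subset _)⟩
  | @insert δ Δ _ _ ih =>
    -- The new hypothesis is moved into the conclusion, which is why `χ` is generalized.
    obtain ⟨φ, hφ, hd⟩ := ih (fun x hx => hΔ (Set.mem_insert_of_mem _ hx)) (.impI h')
    obtain ⟨β, hβ, rfl⟩ := hΔ (Set.mem_insert _ _)
    rcases hG β hβ with hβF | ⟨ψ, hψ, rfl⟩
    · exact ⟨φ, hφ, .impE hd (.hyp (Set.mem_insert_of_mem _ ⟨β, hβF, rfl⟩))⟩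
    · have hself : Proves {(φ ⊓ ψ).all} (φ ⊓ ψ).all := Proves.of_mem rfl
      have h₁ := hi.proves_singleton
        (proves_all_of_proves_all (ψ := φ) (fun Γ w h => h.andLeft) hself)
      have h₂ := hi.proves_singleton
        (proves_all_of_proves_all (ψ := ψ) (fun Γ w h => h.andRight) hself)
      have hsub : {ofSentence (i (φ ⊓ ψ).all)} ⊆
          insert (ofSentence (i (φ ⊓ ψ).all)) (ofSentence '' F) := by simp
      refine ⟨φ ⊓ ψ, hφ.inf hψ, .impE (hd.of_forall ?_) (h₂.mono hsub)⟩
      rintro γ (rfl | hγ)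
      · exact h₁.mono hsub
      · exact .hyp (Set.mem_insert_of_mem _ hγ)

theorem consistent_of_oneConsistent {i : arith.Sentence → L.Sentence} (hi : IsTranslation i)
    {F G : Set L.Sentence} (hG : ∀ β ∈ G, β ∈ F ∨ ∃ φ, TrueSigmaZero φ ∧ i φ.all = β)
    (hF : OneConsistent i F) : Consistent G := by
  rintro ⟨α, h₁, h₂⟩
  rw [Proves, ofSentence_not] at h₂
  obtain ⟨φ, hφ, h⟩ := exists_trueSigmaZero_derivable hi hG
    (Derivable.notE (ψ := BoundedFormula.falsum) h₂ h₁)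
  have hmem : φ.all.not ∈ pullback i F := by
    change Proves F (i φ.all.not)
    rw [hi.map_not, Proves, ofSentence_not]
    exact .notI h
  have hex : ProvesVia i F φ.not.ex := by
    have hnot : Proves (pullback i F) φ.all.not := Proves.of_mem hmem
    have hall : Proves {φ.not.not.all} φ.all := proves_all_of_proves_all
      (φ := φ.not.not) (fun Γ w h => h.notNotE) (Proves.of_mem rfl)
    rw [Proves, ofSentence_not] at hnot
    rw [Proves, Set.image_singleton] at hall
    -- `φ.not.ex` unfolds to `¬∀¬¬φ`; the inner double negation is removed by `hall`.
    change Derivable _ (ofSentence φ.not.not.all.not)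
    rw [ofSentence_not]
    exact .notI (.notE hnot.weaken (hall.mono (by simp)))
  -- `1`-consistency is applied to `¬φ`, which is again `Σ⁰₀`.
  obtain ⟨m, hm⟩ := hF.2 φ.not (.imp hφ.1 .falsum) hex
  refine hm ?_
  have hQ : Derivable (ofSentence '' pullback i F)
      (ofSentence (instantiate φ (Arith.numeral m))) :=
    (Arith.Q_proves_of_realize hφ.1 (hφ.2 m)).of_forall
      (by rintro _ ⟨α, hα, rfl⟩; exact hF.1 α hα)
  have : instantiate φ.not (Arith.numeral m) = (instantiate φ (Arith.numeral m)).not := rfl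
  rw [this, ProvesVia, Proves, ofSentence_not, ofSentence_not]
  exact hQ.notNotI

end Consistency

/-! ### Marked streams and their codes -/

section Streams

variable {B : Type*} {e : B → ℕ}

theorem markedCode_injective (he : Function.Injective e) : Function.Injective (markedCode e) := by
  rintro ⟨b, s⟩ ⟨c, t⟩ h
  obtain ⟨h₁, h₂⟩ := Nat.pair_eq_pair.1 h
  obtain rfl := he h₁
  cases s <;> cases t <;> simp_all

theorem ComputesMarked.mem_iff (he : Function.Injective e) {T : Nat.Partrec.Code}
    {M : ℕ →. B × Bool} (h : ComputesMarked e T M) (n : ℕ) (x : B × Bool) :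
    markedCode e x ∈ T.eval n ↔ x ∈ M n := by
  rw [show T.eval n = (M n).map (markedCode e) from h n, Part.mem_map_iff]
  exact ⟨fun ⟨y, hy, hyx⟩ => markedCode_injective he hyx ▸ hy, fun hx => ⟨x, hx, rfl⟩⟩

theorem ComputesMarked.mem_stabilization_iff (he : Function.Injective e) {T : Nat.Partrec.Code}
    {M : ℕ →. B × Bool} (h : ComputesMarked e T M) (b : B) :
    b ∈ stabilization M ↔ stabilizes T.eval (e b) := by
  simp only [stabilization, stabilizes, Set.mem_ofPred_eq, ← h.mem_iff he]
  rfl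

/-- The map computed is obtained by decoding the values of the machine, so only its defined values
matter. -/
theorem mem_markedMachines [Nonempty B] {T : Nat.Partrec.Code}
    (h : ∀ n, ∀ u ∈ T.eval n, u ∈ Set.range (markedCode e)) : T ∈ markedMachines e := by
  refine ⟨fun n => (T.eval n).map (Function.invFun (markedCode e)), fun n => ?_⟩
  rw [Part.map_map]
  ext u
  rw [Part.mem_map_iff]
  exact ⟨fun hu => ⟨u, hu, Function.invFun_eq (h n u hu)⟩,
    fun ⟨w, hw, hwu⟩ => by rwa [← hwu, Function.comp, Function.invFun_eq (h n w hw)]⟩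

theorem mem_range_markedCode {u : ℕ} :
    u ∈ Set.range (markedCode e) ↔ u.unpair.1 ∈ Set.range e ∧ u.unpair.2 < 2 := by
  constructor
  · rintro ⟨⟨b, s⟩, rfl⟩
    rw [markedCode, Nat.unpair_pair]
    exact ⟨⟨b, rfl⟩, by cases s <;> simp⟩
  · rintro ⟨⟨b, hb⟩, hu⟩
    refine ⟨(b, decide (u.unpair.2 = 1)), ?_⟩
    rw [markedCode, hb]
    conv_rhs => rw [← Nat.pair_unpair u]
    congr 1
    generalize u.unpair.2 = s at hu
    interval_cases s <;> rfl

theorem computable_mem_range_markedCode (he : IsEncoding e) :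
    ComputablePred fun u => u ∈ Set.range (markedCode e) :=
  (computablePred_and (computablePred_comp he.2 (Speculation.computable_unpair_fst .id))
    (computablePred_lt (Speculation.computable_unpair_snd .id) (.const 2))).of_eq
      fun _ => mem_range_markedCode.symm

end Streams

/-! ### The conjectures as a computable sequence of codes -/

section Translation

variable {L : FirstOrder.Language.{u, v}} {e : L.Sentence → ℕ} {i : arith.Sentence → L.Sentence}

/-- Through `Π⁰₁ ⊆ Σ⁰₂`; this is where the index `2` of the translation is used. -/
theorem isSigma_two_all {φ : arith.BoundedFormula Empty 1} (h : Arith.IsSigmaZero φ) :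
    Arith.IsSigma 2 φ.all :=
  .up (b := false) (n := 1) (.all (.up (b := false) (.zero h)))

theorem IsNTranslation.computable_all (hi : IsNTranslation 2 e i) :
    Computable fun k => e (i (Arith.decodeFormula 1 k).all) := by
  obtain ⟨-, T, hT⟩ := hi
  have hcode : Computable fun k => Arith.code (Arith.decodeFormula 1 k).all :=
    Primrec₂.natPair.to_comp.comp (.const 4)
      (Arith.primrec_code_decodeFormula.to_comp.comp ((Computable.const 1).pair .id))
  have heval : Partrec T.eval :=
    Partrec.nat_iff.2 (Nat.Partrec.Code.exists_code.2 ⟨T, rfl⟩)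
  refine (heval.comp hcode).of_eq fun k => ?_
  have := hT ⟨_, isSigma_two_all (Arith.isSigmaZero_decodeFormula 1 k)⟩
  rw [Part.map_some] at this
  exact this

theorem evalFormula_singleton_iff {k m : ℕ} :
    Arith.evalFormula [m] k = true ↔
      (Arith.decodeFormula 1 k).Realize default fun _ => m :=
  Arith.evalFormula_iff (by simp)

end Translation

end StableTheory

theorem theorem3 {L : FirstOrder.Language.{u, v}} (e : L.Sentence → ℕ)
    (he : StableTheory.IsEncoding e) (i : StableTheory.arith.Sentence → L.Sentence)
    (hi : StableTheory.IsNTranslation 2 e i) :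
    ∃ Spec : Nat.Partrec.Code → Nat.Partrec.Code, Computable Spec ∧
      (∀ T, Spec T ∈ StableTheory.markedMachines e) ∧
      ∀ (T : Nat.Partrec.Code) (M Mspec : ℕ →. L.Sentence × Bool),
        StableTheory.ComputesMarked e T M → StableTheory.ComputesMarked e (Spec T) Mspec →
          (StableTheory.ProvesQVia i (StableTheory.stabilization M) →
            StableTheory.Speculative i Mspec ∧
              (StableTheory.IsTotal M → StableTheory.IsTotal Mspec)) ∧
          StableTheory.stabilization M ⊆ StableTheory.stabilization Mspec ∧
          (StableTheory.OneConsistent i (StableTheory.stabilization M) →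
            StableTheory.Consistent (StableTheory.stabilization Mspec)) := by
  classical
  open StableTheory in
  -- The conjecture `∀ m, ⊤` is the filler: it is true, so asserting it at idle positions or in
  -- place of invalid outputs is harmless.
  obtain ⟨k₀, hk₀⟩ := Arith.exists_decodeFormula trueSigmaZero_top.1
  let S : Speculation :=
    { stmt := fun k => e (i (Arith.decodeFormula 1 k).all)
      holds := fun k m => Arith.evalFormula [m] k
      valid := fun u => decide (u ∈ Set.range (markedCode e))
      top := k₀
      holds_congr := fun {j k} h m => by
        have : Arith.decodeFormula 1 j = Arith.decodeFormula 1 k := by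
          simpa using hi.1.injective (he.1 h)
        rw [Bool.eq_iff_iff, evalFormula_singleton_iff, evalFormula_singleton_iff, this]
      holds_top := fun m => by
        rw [evalFormula_singleton_iff, hk₀]
        exact trueSigmaZero_top.2 m }
  have hvalid (u : ℕ) : S.valid u = true ↔ u ∈ Set.range (markedCode e) := decide_eq_true_iff
  have hstmt (b : L.Sentence) (s : Bool) : S.valid (Nat.pair (e b) s.toNat) = true :=
    (hvalid _).2 ⟨(b, s), rfl⟩
  obtain ⟨Spec, hSpec, heval⟩ := S.exists_computable_stream hi.computable_all
    (Arith.primrec_evalFormula.to_comp.comp (Primrec.list_cons.to_comp.comp .snd (.const []))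
      .fst) (computable_mem_range_markedCode he).decide
  refine ⟨Spec, hSpec, fun T => ?_, fun T M Mspec hM hMspec => ?_⟩
  · refine mem_markedMachines fun n u hu => (hvalid u).1 ?_
    rw [heval] at hu
    refine S.valid_of_mem_stream (fun k => ⟨hstmt _ false, hstmt _ true⟩) (fun u hu => ?_) hu
    obtain ⟨⟨b, s⟩, rfl⟩ := (hvalid u).1 hu
    rw [markedCode, Nat.unpair_pair]
    exact hstmt b true
  have hg : ∀ n, ∀ u ∈ T.eval n, S.valid u = true := fun n u hu => by
    rw [show T.eval n = (M n).map (markedCode e) from hM n, Part.mem_map_iff] at hu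
    obtain ⟨x, _, rfl⟩ := hu
    exact (hvalid _).2 ⟨x, rfl⟩
  have heval' : (Spec T).eval = S.stream T.eval := funext (heval T)
  have hstab (b : L.Sentence) : b ∈ stabilization Mspec ↔ stabilizes (S.stream T.eval) (e b) := by
    rw [hMspec.mem_stabilization_iff he.1, heval']
  refine ⟨fun _ => ⟨fun φ hφ h => ?_, fun htot n => ?_⟩, fun b hb => ?_, fun h => ?_⟩
  · obtain ⟨k, rfl⟩ := Arith.exists_decodeFormula hφ
    -- The inner step places the sentence in the pullback; the outer one derives it from there.
    refine Proves.of_mem (Proves.of_mem ((hstab _).2 (Speculation.stabilizes_of_holds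
      (k := k) fun m => evalFormula_singleton_iff.2 ?_)))
    exact Arith.realize_of_Q_proves_instantiate (h m)
  · have : ((Spec T).eval n).Dom := by
      rw [heval]
      refine Speculation.stream_dom (fun n => ?_) n
      rw [show T.eval n = (M n).map (markedCode e) from hM n]
      exact htot n
    rw [show (Spec T).eval n = (Mspec n).map (markedCode e) from hMspec n] at this
    exact this
  · exact (hstab b).2 (Speculation.stabilizes_stream_of_stabilizes hg
      ((hM.mem_stabilization_iff he.1 b).1 hb))
  · refine consistent_of_oneConsistent hi.1 (fun b hb => ?_) h
    rcases Speculation.stabilizes_or_holds_of_stabilizes_stream hg ((hstab b).1 hb)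
      with h | ⟨k, hk, h⟩
    · exact Or.inl ((hM.mem_stabilization_iff he.1 b).2 h)
    · exact Or.inr ⟨_, ⟨Arith.isSigmaZero_decodeFormula 1 k,
        fun m => evalFormula_singleton_iff.1 (h m)⟩, he.1 hk⟩
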